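/- Let $N_t\ge 2$ and $M\ge 1$ be integers. Let $\mathcal F=\{\mathbf v^{(m)}_n : 1\le m\le M,\ 1\le n\le N_t\}$ be a random codebook consisting of $M$ independent random orthonormal bases $\{\mathbf v^{(m)}_1,\dots,\mathbf v^{(m)}_{N_t}\}$ of $\mathbb C^{N_t}$, each one the columns of a Haar-distributed unitary matrix. For each $U$ let $\mathbf h_1,\dots,\mathbf h_U\in\mathbb C^{N_t}$ be the channel vectors of $U$ users, whose coefficients are all i.i.d. $\mathcal{CN}(0,1)$, independent of $\mathcal F$. Put $\mathbf s_u=\mathbf h_u/\|\mathbf h_u\|$, $d(\mathbf v,\mathbf s)=1-|\mathbf v^\dagger\mathbf s|^2$ and let $\epsilon_u=\min_{\mathbf v\in\mathcal F}d(\mathbf v,\mathbf s_u)$ be the quantization error of user $u$. In the interference-limited regime the SINR of user $u$ is $\mathrm{SINR}^{(\alpha)}_u=\frac1{\epsilon_u}-1$. Let $$\mathcal I^{(m)}_n=\bigl\{1\le u\le U : d(\mathbf v^{(m)}_n,\mathbf s_u)<d(\mathbf v,\mathbf s_u)\ \text{ for all } \mathbf v\in\mathcal F,\ \mathbf v\ne\mathbf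 v^{(m)}_n\bigr\}$$ and let $\xi^{(m)}_n=\max_{u\in\mathcal I^{(m)}_n}\mathrm{SINR}^{(\alpha)}_u$, with $\xi^{(m)}_n=0$ if $\mathcal I^{(m)}_n=\emptyset$. The PU2RC throughput is $$R^{(\alpha)}=R^{(\alpha)}(U)=\mathbb E\Bigl[\max_{1\le m\le M}\sum_{n=1}^{N_t}\log\bigl(1+\xi^{(m)}_n\bigr)\Bigr],$$ the expectation being over the codebook and the channels. Then, for $N_t$ and $M$ fixed, this expectation is finite for every $U$ and $$\lim_{U\to\infty}\frac{R^{(\alpha)}(U)}{\frac{N_t}{N_t-1}\log U}=1 .$$ Moreover, for almost every realization of the codebook $\mathcal F$, the same holds (finiteness for every $U$, and the limit) when the codebook is kept fixed and the expectation is taken over the channels only. -/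

import Mathlib

open MeasureTheory ProbabilityTheory Filter Topology

noncomputable section

namespace PU2RC

/-! ### Channel model -/

/-- The circularly symmetric complex Gaussian law `CN(0,1)`: real and imaginary parts are
independent, centred, real Gaussian with variance `1/2`. -/
def complexGaussian : Measure ℂ :=
  ((gaussianReal 0 (1 / 2)).prod (gaussianReal 0 (1 / 2))).map
    Complex.measurableEquivRealProd.symm

/-- The law of the channel vector of one user: i.i.d. `CN(0,1)` coefficients. -/
def channelLaw (Nt : ℕ) : Measure (EuclideanSpace ℂ (Fin Nt)) :=
  (Measure.pi fun _ : Fin Nt => complexGaussian).map (WithLp.toLp 2)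

/-- The joint law of the channel vectors of `U` users: i.i.d. over the users. -/
def channelsLaw (Nt U : ℕ) : Measure (Fin U → EuclideanSpace ℂ (Fin Nt)) :=
  Measure.pi fun _ : Fin U => channelLaw Nt

/-! ### Random codebook -/

instance (Nt : ℕ) : MeasurableSpace (Matrix.unitaryGroup (Fin Nt) ℂ) := borel _

instance (Nt : ℕ) : BorelSpace (Matrix.unitaryGroup (Fin Nt) ℂ) := ⟨rfl⟩

instance (Nt : ℕ) : CompactSpace (Matrix.unitaryGroup (Fin Nt) ℂ) := by
  have hc : IsClosed (Matrix.unitaryGroup (Fin Nt) ℂ : Set (Matrix (Fin Nt) (Fin Nt) ℂ)) :=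
    isClosed_unitary
  have hK : IsCompact (Set.pi Set.univ fun _ : Fin Nt =>
      Set.pi Set.univ fun _ : Fin Nt => Metric.closedBall (0 : ℂ) 1) :=
    isCompact_univ_pi fun _ => isCompact_univ_pi fun _ => isCompact_closedBall 0 1
  refine isCompact_iff_compactSpace.mp (IsCompact.of_isClosed_subset hK hc ?_)
  intro A hA i _ j _
  simpa using entry_norm_bound_of_unitary hA i j

/-- The normalised Haar measure of the unitary group: the columns of a matrix with this law form
a uniformly distributed random orthonormal basis of `ℂ^Nt`. -/
def haarUnitary (Nt : ℕ) : Measure (Matrix.unitaryGroup (Fin Nt) ℂ) :=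
  Measure.haarMeasure ⊤

/-- A codebook of `M` orthonormal bases; the vectors of the `m`-th basis are the columns of the
`m`-th unitary matrix. -/
abbrev Codebook (Nt M : ℕ) : Type := Fin M → Matrix.unitaryGroup (Fin Nt) ℂ

/-- The law of the random codebook: the `M` orthonormal bases are independent and uniform. -/
def codebookLaw (Nt M : ℕ) : Measure (Codebook Nt M) :=
  Measure.pi fun _ : Fin M => haarUnitary Nt

variable {Nt M U : ℕ}

/-- The `n`-th vector of the `m`-th orthonormal basis of the codebook. -/
def codeVec (W : Codebook Nt M) (m : Fin M) (n : Fin Nt) : EuclideanSpace ℂ (Fin Nt) :=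
  WithLp.toLp 2 fun i => (W m : Matrix (Fin Nt) (Fin Nt) ℂ) i n

/-! ### Quantization of the channel shape -/

/-- The channel shape `h / ‖h‖`. -/
def shape (h : EuclideanSpace ℂ (Fin Nt)) : EuclideanSpace ℂ (Fin Nt) :=
  ((‖h‖⁻¹ : ℝ) : ℂ) • h

/-- The distortion `d(v, s) = 1 - |v† s|²`. -/
def distortion (v s : EuclideanSpace ℂ (Fin Nt)) : ℝ :=
  1 - ‖inner ℂ v s‖ ^ 2

/-- The quantization error of a user with channel `h`: the distortion between the channel shape
and the closest vector of the codebook, i.e. a minimum over the finitely many code vectors. -/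
def quantError (W : Codebook Nt M) (h : EuclideanSpace ℂ (Fin Nt)) : ℝ :=
  ⨅ p : Fin M × Fin Nt, distortion (codeVec W p.1 p.2) (shape h)

/-- The SINR in the interference-limited regime. -/
def sinr (W : Codebook Nt M) (h : EuclideanSpace ℂ (Fin Nt)) : ℝ :=
  1 / quantError W h - 1

/-! ### Scheduling and throughput -/

open Classical in
/-- The set of the users whose channel shape is strictly closer to the `n`-th vector of the `m`-th
basis than to every other vector of the codebook. -/
def userSet (W : Codebook Nt M) (h : Fin U → EuclideanSpace ℂ (Fin Nt))
    (m : Fin M) (n : Fin Nt) : Finset (Fin U) :=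
  Finset.univ.filter fun u => ∀ (m' : Fin M) (n' : Fin Nt), codeVec W m' n' ≠ codeVec W m n →
    distortion (codeVec W m n) (shape (h u)) < distortion (codeVec W m' n') (shape (h u))

open Classical in
/-- The maximal SINR among the users associated with a code vector; zero if there is none. -/
def maxSinr (W : Codebook Nt M) (h : Fin U → EuclideanSpace ℂ (Fin Nt))
    (m : Fin M) (n : Fin Nt) : ℝ :=
  if hne : (userSet W h m n).Nonempty then (userSet W h m n).sup' hne fun u => sinr W (h u) else 0

/-- The sum rate of the scheduled users: the maximum over the `M` bases. -/
def sumRate (W : Codebook Nt M) (h : Fin U → EuclideanSpace ℂ (Fin Nt)) : ℝ :=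
  ⨆ m : Fin M, ∑ n : Fin Nt, Real.log (1 + maxSinr W h m n)

/-- The ergodic throughput for `U` users: the mean of the sum rate over codebook and channels. -/
def throughput (Nt M U : ℕ) : ℝ :=
  ∫ x : Codebook Nt M × (Fin U → EuclideanSpace ℂ (Fin Nt)), sumRate x.1 x.2
    ∂((codebookLaw Nt M).prod (channelsLaw Nt U))

/-- The ergodic throughput for `U` users and a fixed codebook: the mean over the channels only. -/
def codebookThroughput (W : Codebook Nt M) (U : ℕ) : ℝ :=
  ∫ h : Fin U → EuclideanSpace ℂ (Fin Nt), sumRate W h ∂(channelsLaw Nt U)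

end PU2RC

end

noncomputable section

namespace PU2RC

variable {Nt M U : ℕ}

/-! ### Gaussian estimates -/

/-! Since `log (1 + SINR) = -log ε`, the throughput is governed by the lower tail of the distortion
`d` between a code vector and a channel shape, which behaves like `P(d < x) ≈ x ^ (Nt - 1)`. The
best of `U` users then has error about `U ^ (-1 / (Nt - 1))`, and each of the `Nt` beams contributes
about `log U / (Nt - 1)`.

Both tail estimates start from unitary invariance of the Gaussian law (`map_channelLaw`): the code
vector may be taken to be a coordinate vector, where `d` is an explicit quotient of sums of `‖h i‖ ^
2`.

Upper bound: `d ^ (-lam)` has finite mean for every `lam < Nt - 1` (`exists_distortion_moment`).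
Linearizing the logarithm at a point of order `U` bounds the maximum over users by a sum, and taking
means gives `Nt / lam * (log U + const)`, with a constant uniform in the codebook
(`exists_codebookThroughput_le`). Then `lam` tends to `Nt - 1`.

Lower bound: keep a single basis. If none of its vectors is parallel to another code vector, the
cell of each contains a whole ball of small distortion (`distortion_lt_of_lt`). By
`exists_distortion_small_ball`, balls of radius `U ^ (-(1 - δ) / (Nt - 1))` contain some user with
probability tending to 1, so the ratio is eventually at least nearly `1 - δ`.

Haar codebooks almost surely have this separation (`ae_isSeparated`), which gives the statement for
fixed codebooks. The averaged one follows by dominated convergence, with the uniform upper bound as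
majorant. -/

theorem one_add_rpow_le {y lam : ℝ} (hy : 0 ≤ y) (hl : 0 ≤ lam) :
    (1 + y) ^ lam ≤ (1 + 4 * lam) ^ lam * Real.exp (y / 4) := by
  have hK : 0 < 1 + 4 * lam := by positivity
  -- The scale `1 + 4 * lam` is at least 1, and it makes the final exponent `lam / (1 + 4 * lam)` at
  -- most `1 / 4`.
  have h1 : 1 + y ≤ (1 + 4 * lam) * Real.exp (y / (1 + 4 * lam)) := by
    have h2 := Real.add_one_le_exp (y / (1 + 4 * lam))
    have h3 : (1 + 4 * lam) * (y / (1 + 4 * lam) + 1) = y + (1 + 4 * lam) := by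
      field_simp
    nlinarith [mul_le_mul_of_nonneg_left h2 hK.le]
  calc (1 + y) ^ lam ≤ ((1 + 4 * lam) * Real.exp (y / (1 + 4 * lam))) ^ lam :=
        Real.rpow_le_rpow (by positivity) h1 hl
    _ = (1 + 4 * lam) ^ lam * Real.exp (y / (1 + 4 * lam) * lam) := by
        rw [Real.mul_rpow hK.le (Real.exp_pos _).le, ← Real.exp_mul]
    _ ≤ _ := by
        gcongr
        rw [div_mul_eq_mul_div, div_le_div_iff₀ hK (by norm_num)]
        nlinarith

theorem integrable_gaussian_moment {lam mu : ℝ} (hl : 0 ≤ lam) (hm : mu < 1) :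
    Integrable (fun x : ℝ => (1 + x ^ 2) ^ lam * |x| ^ (-mu)) (gaussianReal 0 (1 / 2)) := by
  have hv : (1 / 2 : NNReal) ≠ 0 := by norm_num
  rw [gaussianReal_of_var_ne_zero _ hv,
    integrable_withDensity_iff_integrable_smul' (measurable_gaussianPDF _ _)
      (ae_of_all _ fun x => by simp [gaussianPDF])]
  -- With variance `1 / 2` the density is proportional to `exp (-x ^ 2)`; a quarter of the exponent
  -- is spent on absorbing `(1 + x ^ 2) ^ lam`.
  have h0 : Integrable (fun x : ℝ => |x| ^ (-mu) * Real.exp (-(3 / 4) * x ^ 2)) := by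
    have h := integrableOn_rpow_mul_exp_neg_mul_sq (b := 3 / 4) (by norm_num)
      (s := -mu) (by linarith)
    have h' : IntegrableOn (fun x : ℝ => |x| ^ (-mu) * Real.exp (-(3 / 4) * x ^ 2)) (Set.Ioi 0) :=
      h.congr_fun (fun x hx => by rw [abs_of_pos hx]) measurableSet_Ioi
    rw [← integrableOn_univ, ← Set.Iio_union_Ici (a := (0 : ℝ)), integrableOn_union,
      integrableOn_Ici_iff_integrableOn_Ioi]
    refine ⟨?_, h'⟩
    rw [← (Measure.measurePreserving_neg (volume : Measure ℝ)).integrableOn_comp_preimage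
        (Homeomorph.neg ℝ).measurableEmbedding]
    simpa [Function.comp_def] using h'
  refine (h0.const_mul ((√(2 * Real.pi * (1 / 2)))⁻¹ * (1 + 4 * lam) ^ lam)).mono
    (Measurable.aestronglyMeasurable (by fun_prop)) (ae_of_all _ fun x => ?_)
  have h1 := one_add_rpow_le (sq_nonneg x) hl
  have h2 : Real.exp (x ^ 2 / 4) * Real.exp (-x ^ 2) = Real.exp (-(3 / 4) * x ^ 2) := by
    rw [← Real.exp_add]; ring_nf
  have hA : 0 ≤ |x| ^ (-mu) := by positivity
  simp only [gaussianPDF, smul_eq_mul, gaussianPDFReal, norm_mul]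
  rw [ENNReal.toReal_ofReal (by positivity)]
  simp only [Real.norm_eq_abs, NNReal.coe_div, NNReal.coe_one, NNReal.coe_ofNat, sub_zero, abs_mul,
    Real.abs_exp, abs_abs, Real.abs_rpow_of_nonneg (abs_nonneg x),
    Real.abs_rpow_of_nonneg (show 0 ≤ 1 + x ^ 2 by positivity),
    abs_of_nonneg (show 0 ≤ 1 + x ^ 2 by positivity),
    abs_of_nonneg (show 0 ≤ (1 + 4 * lam) ^ lam by positivity)]
  rw [← h2, show -x ^ 2 / (2 * (1 / 2 : ℝ)) = -x ^ 2 by ring]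
  have h3 := mul_le_mul_of_nonneg_left h1
    (show 0 ≤ |(√(2 * Real.pi * (1 / 2)))⁻¹| * |x| ^ (-mu) * Real.exp (-x ^ 2) by positivity)
  linarith

theorem gaussian_Ioo_lower :
    ∃ c : ℝ, 0 < c ∧ ∀ a b : ℝ, 0 ≤ a → a ≤ b → b ≤ 2 →
      ENNReal.ofReal (c * (b - a)) ≤ gaussianReal 0 (1 / 2) (Set.Ioo a b) := by
  have hv : (1 / 2 : NNReal) ≠ 0 := by norm_num
  -- The density decreases on `[0, 2]`, so its value at 2 is a lower bound there.
  refine ⟨gaussianPDFReal 0 (1 / 2) 2, gaussianPDFReal_pos _ _ _ hv, fun a b ha hab hb => ?_⟩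
  rw [gaussianReal_apply _ hv]
  calc ENNReal.ofReal (gaussianPDFReal 0 (1 / 2) 2 * (b - a))
      = ∫⁻ _ in Set.Ioo a b, ENNReal.ofReal (gaussianPDFReal 0 (1 / 2) 2) := by
        rw [setLIntegral_const, Real.volume_Ioo,
          ENNReal.ofReal_mul (gaussianPDFReal_nonneg _ _ _)]
    _ ≤ _ := by
        refine setLIntegral_mono (measurable_gaussianPDF _ _) fun x hx => ?_
        refine ENNReal.ofReal_le_ofReal ?_
        simp only [gaussianPDFReal]
        gcongr
        · linarith [hx.1]
        · linarith [hx.2]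

instance : IsProbabilityMeasure complexGaussian :=
  Measure.isProbabilityMeasure_map (by fun_prop)

theorem complexGaussian_rect {A B : Set ℝ} (hA : MeasurableSet A) (hB : MeasurableSet B) :
    complexGaussian {z | z.re ∈ A ∧ z.im ∈ B} =
      gaussianReal 0 (1 / 2) A * gaussianReal 0 (1 / 2) B := by
  have hm : MeasurableSet {z : ℂ | z.re ∈ A ∧ z.im ∈ B} :=
    (Complex.measurable_re hA).inter (Complex.measurable_im hB)
  rw [complexGaussian, Measure.map_apply (by fun_prop) hm, ← Measure.prod_prod]
  rfl

theorem integrable_complexGaussian {f g : ℝ → ℝ} (hf : Integrable f (gaussianReal 0 (1 / 2)))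
    (hg : Integrable g (gaussianReal 0 (1 / 2))) :
    Integrable (fun z : ℂ => f z.re * g z.im) complexGaussian := by
  rw [complexGaussian, integrable_map_equiv]
  exact hf.mul_prod hg

theorem ae_complexGaussian_ne_zero : ∀ᵐ z ∂complexGaussian, z.re ≠ 0 ∧ z.im ≠ 0 := by
  have := nullSingletonClass_gaussianReal (μ := 0) (v := 1 / 2) (by norm_num)
  have h1 : complexGaussian {z | z.re ∈ ({0} : Set ℝ) ∧ z.im ∈ Set.univ} = 0 := by
    rw [complexGaussian_rect (measurableSet_singleton _) MeasurableSet.univ, measure_singleton, zero_mul]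
  have h2 : complexGaussian {z | z.re ∈ Set.univ ∧ z.im ∈ ({0} : Set ℝ)} = 0 := by
    rw [complexGaussian_rect MeasurableSet.univ (measurableSet_singleton _), measure_singleton,
      mul_zero]
  have h3 := measure_eq_zero_iff_ae_notMem.1 h1
  have h4 := measure_eq_zero_iff_ae_notMem.1 h2
  filter_upwards [h3, h4] with z hz1 hz2
  simp_all

theorem charFun_complexGaussian (t : ℂ) :
    charFun complexGaussian t = Complex.exp (-‖t‖ ^ 2 / 4) := by
  rw [charFun_apply, complexGaussian, integral_map_equiv]
  have h : ∀ p : ℝ × ℝ, Complex.exp (inner ℝ (Complex.measurableEquivRealProd.symm p) t *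
      Complex.I) = Complex.exp (inner ℝ p.1 t.re * Complex.I) *
        Complex.exp (inner ℝ p.2 t.im * Complex.I) := by
    intro p
    rw [← Complex.exp_add, ← add_mul, ← Complex.ofReal_add, Complex.inner]
    simp [Complex.measurableEquivRealProd]
  simp_rw [h]
  rw [integral_prod_mul (fun x : ℝ => Complex.exp (inner ℝ x t.re * Complex.I))
    (fun x : ℝ => Complex.exp (inner ℝ x t.im * Complex.I)), ← charFun_apply, ← charFun_apply,
    charFun_gaussianReal, charFun_gaussianReal, ← Complex.exp_add]
  congr 1
  have h5 : (‖t‖ : ℂ) ^ 2 = (t.re : ℂ) ^ 2 + (t.im : ℂ) ^ 2 := by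
    rw [← Complex.ofReal_pow, Complex.sq_norm, Complex.normSq_apply]; push_cast; ring
  rw [h5]
  push_cast
  ring

/-! ### Unitary invariance of the channel law -/

instance : IsProbabilityMeasure (channelLaw Nt) :=
  Measure.isProbabilityMeasure_map (by fun_prop)

instance : IsProbabilityMeasure (channelsLaw Nt U) := by
  unfold channelsLaw; infer_instance

theorem real_inner_eq_re_inner (x y : EuclideanSpace ℂ (Fin Nt)) :
    inner ℝ x y = (inner ℂ x y).re := by
  simp [PiLp.inner_apply, Complex.inner]

theorem charFun_channelLaw (t : EuclideanSpace ℂ (Fin Nt)) :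
    charFun (channelLaw Nt) t = Complex.exp (-‖t‖ ^ 2 / 4) := by
  rw [channelLaw, charFun_pi]
  simp_rw [charFun_complexGaussian, ← Complex.exp_sum]
  congr 1
  rw [← Complex.ofReal_pow, EuclideanSpace.norm_sq_eq]
  push_cast
  rw [← Finset.sum_div, Finset.sum_neg_distrib]

/-- The characteristic function depends on `t` only through `‖t‖`, which an isometry preserves. -/
theorem map_channelLaw
    (T : EuclideanSpace ℂ (Fin Nt) ≃ₗᵢ[ℂ] EuclideanSpace ℂ (Fin Nt)) :
    (channelLaw Nt).map T = channelLaw Nt := by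
  have hT : Measurable T := T.continuous.measurable
  have : IsProbabilityMeasure ((channelLaw Nt).map T) :=
    Measure.isProbabilityMeasure_map hT.aemeasurable
  refine Measure.ext_of_charFun (funext fun t => ?_)
  have h : charFun ((channelLaw Nt).map T) t = charFun (channelLaw Nt) (T.symm t) := by
    rw [charFun_apply, charFun_apply, integral_map hT.aemeasurable]
    · refine integral_congr_ae (ae_of_all _ fun x => ?_)
      simp only
      rw [real_inner_eq_re_inner, real_inner_eq_re_inner, ← T.inner_map_map x (T.symm t),
        T.apply_symm_apply]
    · exact Measurable.aestronglyMeasurable (by fun_prop)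
  rw [h, charFun_channelLaw, charFun_channelLaw, T.symm.norm_map]

theorem exists_isometry_map_eq_single (v : EuclideanSpace ℂ (Fin Nt)) (hv : ‖v‖ = 1)
    (j : Fin Nt) : ∃ T : EuclideanSpace ℂ (Fin Nt) ≃ₗᵢ[ℂ] EuclideanSpace ℂ (Fin Nt),
      T v = EuclideanSpace.single j 1 := by
  have ho : Orthonormal ℂ (({j} : Set (Fin Nt)).domRestrict fun _ => v) := by
    refine ⟨fun _ => hv, fun a b hab => (hab (Subsingleton.elim a b)).elim⟩
  obtain ⟨b, hb⟩ := ho.exists_orthonormalBasis_extension_of_card_eq (by simp)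
  refine ⟨b.repr, ?_⟩
  rw [← hb j rfl, b.repr_self]

theorem shape_map (T : EuclideanSpace ℂ (Fin Nt) ≃ₗᵢ[ℂ] EuclideanSpace ℂ (Fin Nt))
    (h : EuclideanSpace ℂ (Fin Nt)) : shape (T h) = T (shape h) := by
  simp [shape]

theorem measurable_shape : Measurable (shape : EuclideanSpace ℂ (Fin Nt) → _) := by
  unfold shape; fun_prop

theorem measurable_distortion_shape (v : EuclideanSpace ℂ (Fin Nt)) :
    Measurable fun h => distortion v (shape h) := by
  have := measurable_shape (Nt := Nt)
  unfold distortion; fun_prop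

/-- The law of the distortion is the same for all code vectors. -/
theorem map_distortion_shape (v : EuclideanSpace ℂ (Fin Nt)) (hv : ‖v‖ = 1) (j : Fin Nt) :
    (channelLaw Nt).map (fun h => distortion v (shape h)) =
      (channelLaw Nt).map (fun h => distortion (EuclideanSpace.single j 1) (shape h)) := by
  obtain ⟨T, hT⟩ := exists_isometry_map_eq_single v hv j
  conv_rhs => rw [← map_channelLaw T]
  rw [Measure.map_map (measurable_distortion_shape _) T.continuous.measurable]
  congr 1
  ext h
  simp only [Function.comp_apply, shape_map, ← hT, distortion, T.inner_map_map]

/-! ### Pointwise formulas for the distortion -/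

theorem norm_shape {h : EuclideanSpace ℂ (Fin Nt)} (hh : h ≠ 0) : ‖shape h‖ = 1 := by
  rw [shape, norm_smul]
  simp [hh]

theorem norm_shape_le (h : EuclideanSpace ℂ (Fin Nt)) : ‖shape h‖ ≤ 1 := by
  by_cases hh : h = 0
  · simp [hh, shape]
  · exact (norm_shape hh).le

theorem distortion_le_one (v s : EuclideanSpace ℂ (Fin Nt)) : distortion v s ≤ 1 := by
  unfold distortion; nlinarith [sq_nonneg ‖inner ℂ v s‖]

theorem distortion_shape_nonneg {v : EuclideanSpace ℂ (Fin Nt)} (hv : ‖v‖ = 1)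
    (h : EuclideanSpace ℂ (Fin Nt)) : 0 ≤ distortion v (shape h) := by
  have h1 : ‖inner ℂ v (shape h)‖ ≤ 1 := by
    refine (norm_inner_le_norm _ _).trans ?_
    rw [hv, one_mul]; exact norm_shape_le h
  unfold distortion
  nlinarith [norm_nonneg (inner ℂ v (shape h))]

theorem distortion_single_shape (j : Fin Nt) {h : EuclideanSpace ℂ (Fin Nt)} (hh : h ≠ 0) :
    distortion (EuclideanSpace.single j 1) (shape h) =
      (∑ i ∈ Finset.univ.erase j, ‖h i‖ ^ 2) / ‖h‖ ^ 2 := by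
  have hn : ‖h‖ ≠ 0 := norm_ne_zero_iff.2 hh
  have h1 := Finset.sum_erase_add Finset.univ (fun i => ‖h i‖ ^ 2) (Finset.mem_univ j)
  rw [← EuclideanSpace.norm_sq_eq] at h1
  rw [distortion, shape, inner_smul_right, norm_mul, EuclideanSpace.inner_single_left]
  simp only [map_one, one_mul, Complex.norm_real, norm_inv, norm_norm]
  field_simp
  linarith

theorem sum_le_prod_one_add {ι : Type*} (s : Finset ι) (a : ι → ℝ) (ha : ∀ i, 0 ≤ a i) :
    ∑ i ∈ s, a i ≤ ∏ i ∈ s, (1 + a i) := by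
  have h : 1 + ∑ i ∈ s, a i ≤ ∏ i ∈ s, (1 + a i) := by
    classical
    induction s using Finset.induction_on with
    | empty => simp
    | insert i s hi ih =>
      rw [Finset.sum_insert hi, Finset.prod_insert hi]
      have := Finset.sum_nonneg (s := s) fun i _ => ha i
      nlinarith [ha i]
  linarith

theorem normSq_eq (z : ℂ) : ‖z‖ ^ 2 = z.re ^ 2 + z.im ^ 2 := by
  rw [Complex.sq_norm, Complex.normSq_apply]; ring

/-- The integrand that dominates a negative moment of the distortion. -/
def momentWeight (lam mu : ℝ) (x : ℝ) : ℝ := (1 + x ^ 2) ^ lam * |x| ^ (-mu)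

/-- AM-GM with equal weights `1 / (Nt - 1)` bounds the numerator of `d` below by a product over the
coordinates other than `j`, and `‖h‖ ^ 2` is below a product of factors `1 + x ^ 2`. The bound
therefore factorizes over independent real Gaussians. Each singular exponent is `lam / (Nt - 1)`,
which is integrable exactly when `lam < Nt - 1`; coordinate `j` has no singularity. -/
theorem distortion_rpow_le (hNt : 2 ≤ Nt) (j : Fin Nt) {lam : ℝ} (hl : 0 ≤ lam)
    {h : EuclideanSpace ℂ (Fin Nt)} (hh : ∀ i, (h i).re ≠ 0 ∧ (h i).im ≠ 0) :
    distortion (EuclideanSpace.single j 1) (shape h) ^ (-lam) ≤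
      ∏ i, (momentWeight lam (if i = j then 0 else lam / (Nt - 1)) (h i).re *
        momentWeight lam (if i = j then 0 else lam / (Nt - 1)) (h i).im) := by
  have hN : (0 : ℝ) < Nt - 1 := by
    have : (2 : ℝ) ≤ Nt := by exact_mod_cast hNt
    linarith
  have h0 : h ≠ 0 := by
    rintro rfl
    exact (hh j).1 rfl
  have hz : ∀ i, 0 < ‖h i‖ ^ 2 := fun i => by
    have := (hh i).1
    rw [normSq_eq]; positivity
  have hn : 0 < ‖h‖ ^ 2 := by have := norm_pos_iff.2 h0; positivity
  set w : ℝ := 1 / (Nt - 1) with hw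
  have hcard : ((Finset.univ.erase j).card : ℝ) = Nt - 1 := by
    rw [Finset.card_erase_of_mem (Finset.mem_univ j), Finset.card_univ, Fintype.card_fin,
      Nat.cast_sub (by omega), Nat.cast_one]
  have hP : 0 < ∏ i ∈ Finset.univ.erase j, (|(h i).re| * |(h i).im|) ^ w := by
    refine Finset.prod_pos fun i _ => Real.rpow_pos_of_pos ?_ _
    exact mul_pos (abs_pos.2 (hh i).1) (abs_pos.2 (hh i).2)
  have hrho : ∏ i ∈ Finset.univ.erase j, (|(h i).re| * |(h i).im|) ^ w ≤
      ∑ i ∈ Finset.univ.erase j, ‖h i‖ ^ 2 := by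
    have hw0 : 0 ≤ w := by positivity
    have hw1 : w ≤ 1 := by
      rw [hw, div_le_one hN]
      have : (2 : ℝ) ≤ Nt := by exact_mod_cast hNt
      linarith
    calc _ ≤ ∏ i ∈ Finset.univ.erase j, (‖h i‖ ^ 2) ^ w := by
          refine Finset.prod_le_prod (fun i _ => by positivity) fun i _ => ?_
          refine Real.rpow_le_rpow (by positivity) ?_ hw0
          rw [normSq_eq, ← sq_abs (h i).re, ← sq_abs (h i).im]
          nlinarith [sq_nonneg (|(h i).re| - |(h i).im|), abs_nonneg (h i).re,
            abs_nonneg (h i).im]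
      _ ≤ ∑ i ∈ Finset.univ.erase j, w * ‖h i‖ ^ 2 := by
          refine Real.geom_mean_le_arith_mean_weighted _ (fun _ => w) _ (fun _ _ => hw0) ?_
            fun i _ => (hz i).le
          rw [Finset.sum_const, nsmul_eq_mul, hcard, hw]
          field_simp
      _ ≤ _ := by
          refine Finset.sum_le_sum fun i _ => ?_
          nlinarith [(hz i).le]
  have hup : ‖h‖ ^ 2 ≤ ∏ i, ((1 + (h i).re ^ 2) * (1 + (h i).im ^ 2)) := by
    rw [EuclideanSpace.norm_sq_eq]
    refine (sum_le_prod_one_add _ _ fun i => by positivity).trans ?_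
    refine Finset.prod_le_prod (fun i _ => by positivity) fun i _ => ?_
    rw [normSq_eq]
    nlinarith [mul_nonneg (sq_nonneg (h i).re) (sq_nonneg (h i).im)]
  rw [distortion_single_shape j h0, Real.div_rpow (hP.le.trans hrho) hn.le, div_eq_mul_inv,
    ← Real.rpow_neg hn.le, neg_neg, mul_comm]
  have e1 : (‖h‖ ^ 2) ^ lam ≤ ∏ i, ((1 + (h i).re ^ 2) ^ lam * (1 + (h i).im ^ 2) ^ lam) := by
    refine (Real.rpow_le_rpow hn.le hup hl).trans_eq ?_
    rw [← Real.finsetProd_rpow _ _ fun i _ => by positivity]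
    exact Finset.prod_congr rfl fun i _ => Real.mul_rpow (by positivity) (by positivity)
  have e2 : (∑ i ∈ Finset.univ.erase j, ‖h i‖ ^ 2) ^ (-lam) ≤
      ∏ i, (|(h i).re| ^ (-(if i = j then 0 else lam / (Nt - 1))) *
        |(h i).im| ^ (-(if i = j then 0 else lam / (Nt - 1)))) := by
    refine (Real.rpow_le_rpow_of_nonpos hP hrho (by linarith)).trans_eq ?_
    rw [← Real.finsetProd_rpow _ _ fun i _ => by positivity,
      ← Finset.mul_prod_erase Finset.univ _ (Finset.mem_univ j)]
    simp only [if_true, neg_zero, Real.rpow_zero, one_mul]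
    refine Finset.prod_congr rfl fun i hi => ?_
    rw [if_neg (Finset.ne_of_mem_erase hi), ← Real.rpow_mul (by positivity),
      Real.mul_rpow (abs_nonneg _) (abs_nonneg _), hw]
    congr 2 <;> ring
  calc _ ≤ _ := mul_le_mul e1 e2 (by positivity) (by positivity)
    _ = _ := by
      rw [← Finset.prod_mul_distrib]
      refine Finset.prod_congr rfl fun i _ => ?_
      simp only [momentWeight]
      ring

theorem ae_channelLaw_ne_zero :
    ∀ᵐ h ∂(channelLaw Nt), ∀ i, (h i).re ≠ 0 ∧ (h i).im ≠ 0 := by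
  rw [channelLaw, ae_map_iff (by fun_prop)]
  · rw [ae_all_iff]
    intro i
    exact (Measure.tendsto_eval_ae_ae (μ := fun _ : Fin Nt => complexGaussian) (i := i)).eventually
      ae_complexGaussian_ne_zero
  · simp only [Set.ofPred_forall]
    refine MeasurableSet.iInter fun i => ?_
    have h1 : Measurable fun h : EuclideanSpace ℂ (Fin Nt) => (h i).re := by fun_prop
    have h2 : Measurable fun h : EuclideanSpace ℂ (Fin Nt) => (h i).im := by fun_prop
    exact (h1 (measurableSet_singleton 0).compl).inter (h2 (measurableSet_singleton 0).compl)

/-- Negative moments of the distortion, uniformly over the code vectors. -/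
theorem exists_distortion_moment (hNt : 2 ≤ Nt) {lam : ℝ} (hl : 0 ≤ lam) (hl' : lam < Nt - 1) :
    ∃ C : ℝ, 0 ≤ C ∧ ∀ v : EuclideanSpace ℂ (Fin Nt), ‖v‖ = 1 →
      Integrable (fun h => distortion v (shape h) ^ (-lam)) (channelLaw Nt) ∧
        ∫ h, distortion v (shape h) ^ (-lam) ∂(channelLaw Nt) = C := by
  have hN : (0 : ℝ) < Nt - 1 := by
    have : (2 : ℝ) ≤ Nt := by exact_mod_cast hNt
    linarith
  let j : Fin Nt := ⟨0, by omega⟩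
  have hmeas : Measurable fun y : ℝ => y ^ (-lam) := by fun_prop
  have hint : Integrable (fun h => distortion (EuclideanSpace.single j 1) (shape h) ^ (-lam))
      (channelLaw Nt) := by
    have hw : ∀ i : Fin Nt, Integrable (fun z : ℂ =>
        momentWeight lam (if i = j then 0 else lam / (Nt - 1)) z.re *
        momentWeight lam (if i = j then 0 else lam / (Nt - 1)) z.im) complexGaussian := by
      intro i
      have : (if i = j then 0 else lam / (Nt - 1)) < 1 := by
        split_ifs
        · norm_num
        · rwa [div_lt_one hN]
      exact integrable_complexGaussian (integrable_gaussian_moment hl this)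
        (integrable_gaussian_moment hl this)
    have hprod : Integrable (fun h : EuclideanSpace ℂ (Fin Nt) =>
        ∏ i, (momentWeight lam (if i = j then 0 else lam / (Nt - 1)) (h i).re *
        momentWeight lam (if i = j then 0 else lam / (Nt - 1)) (h i).im)) (channelLaw Nt) := by
      rw [channelLaw, ← MeasurableEquiv.coe_toLp, integrable_map_equiv]
      exact Integrable.fintype_prod hw
    refine hprod.mono'
      (hmeas.comp (measurable_distortion_shape _)).aestronglyMeasurable ?_
    filter_upwards [ae_channelLaw_ne_zero] with h hh
    rw [Real.norm_of_nonneg (Real.rpow_nonneg (distortion_shape_nonneg (by simp) h) _)]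
    exact distortion_rpow_le hNt j hl hh
  refine ⟨∫ h, distortion (EuclideanSpace.single j 1) (shape h) ^ (-lam) ∂(channelLaw Nt),
    integral_nonneg fun h => Real.rpow_nonneg (distortion_shape_nonneg (by simp) h) _,
    fun v hv => ?_⟩
  have hm := map_distortion_shape v hv j
  have hM := fun w : EuclideanSpace ℂ (Fin Nt) => (measurable_distortion_shape w).aemeasurable
    (μ := channelLaw Nt)
  constructor
  · refine (integrable_map_measure (g := fun y : ℝ => y ^ (-lam)) hmeas.aestronglyMeasurable
      (hM v)).1 ?_
    rw [hm]
    exact (integrable_map_measure hmeas.aestronglyMeasurable (hM _)).2 hint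
  · rw [← integral_map (hM v) (f := fun y : ℝ => y ^ (-lam)) hmeas.aestronglyMeasurable, hm,
      integral_map (hM _) hmeas.aestronglyMeasurable]

/-- Small balls of the distortion have at least the volume of complex balls of dimension
`Nt - 1`, up to a constant. -/
theorem exists_distortion_small_ball (hNt : 2 ≤ Nt) :
    ∃ c : ℝ, 0 < c ∧ ∀ v : EuclideanSpace ℂ (Fin Nt), ‖v‖ = 1 → ∀ x : ℝ, 0 < x → x ≤ 1 →
      ENNReal.ofReal (c * x ^ ((Nt : ℝ) - 1)) ≤
        channelLaw Nt {h | 0 < distortion v (shape h) ∧ distortion v (shape h) < x} := by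
  obtain ⟨c, hc, hcI⟩ := gaussian_Ioo_lower
  let j : Fin Nt := ⟨0, by omega⟩
  have hN2 : (2 : ℝ) ≤ Nt := by exact_mod_cast hNt
  have hN : (0 : ℝ) < Nt - 1 := by linarith
  -- The first factor is the mass bound for coordinate `j`, whose real and imaginary parts range
  -- over intervals of length `1 / 2`. Each of the `Nt - 1` others contributes `(c * a) ^ 2 = c ^ 2
  -- / (2 * Nt) * x`.
  refine ⟨(c * (1 / 2)) ^ 2 * (c ^ 2 / (2 * Nt)) ^ (Nt - 1), by positivity,
    fun v hv x hx hx1 => ?_⟩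
  have hset : ∀ w : EuclideanSpace ℂ (Fin Nt),
      channelLaw Nt {h | 0 < distortion w (shape h) ∧ distortion w (shape h) < x} =
      (channelLaw Nt).map (fun h => distortion w (shape h)) (Set.Ioo 0 x) := fun w => by
    rw [Measure.map_apply (measurable_distortion_shape _) measurableSet_Ioo]; rfl
  rw [hset, map_distortion_shape v hv j, ← hset]
  set a : ℝ := √(x / (2 * Nt)) with ha
  have ha2 : a ^ 2 = x / (2 * Nt) := Real.sq_sqrt (by positivity)
  have ha0 : 0 < a := Real.sqrt_pos.2 (by positivity)
  have ha1 : a ≤ 1 := by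
    rw [ha, Real.sqrt_le_one, div_le_one (by positivity)]
    linarith
  -- On this box `‖h j‖ ^ 2 > 1`, while every other coordinate has `0 < ‖h i‖ ^ 2 < x / Nt`, so `0 <
  -- d < x`.
  let lo : Fin Nt → ℝ := fun i => if i = j then 1 else 0
  let hi : Fin Nt → ℝ := fun i => if i = j then 3 / 2 else a
  have hsub : (WithLp.toLp 2 : (Fin Nt → ℂ) → EuclideanSpace ℂ (Fin Nt)) ⁻¹'
        {h | 0 < distortion (EuclideanSpace.single j 1) (shape h) ∧
          distortion (EuclideanSpace.single j 1) (shape h) < x} ⊇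
      Set.pi Set.univ fun i => {z : ℂ | z.re ∈ Set.Ioo (lo i) (hi i) ∧
        z.im ∈ Set.Ioo (lo i) (hi i)} := by
    intro f hf
    set h : EuclideanSpace ℂ (Fin Nt) := WithLp.toLp 2 f with hhdef
    have hfi : ∀ i, (h i).re ∈ Set.Ioo (lo i) (hi i) ∧ (h i).im ∈ Set.Ioo (lo i) (hi i) :=
      fun i => hf i trivial
    have hj : 1 < ‖h j‖ ^ 2 := by
      have := hfi j
      simp only [lo, hi, if_true] at this
      rw [normSq_eq]
      nlinarith [this.1.1, this.2.1]
    have hne : h ≠ 0 := by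
      intro h0
      rw [h0] at hj
      norm_num at hj
    have hi' : ∀ i ∈ Finset.univ.erase j, 0 < ‖h i‖ ^ 2 ∧ ‖h i‖ ^ 2 < x / Nt := by
      intro i hij
      have := hfi i
      simp only [lo, hi, if_neg (Finset.ne_of_mem_erase hij)] at this
      obtain ⟨⟨h1, h2⟩, h3, h4⟩ := this
      rw [normSq_eq]
      refine ⟨by positivity, ?_⟩
      have : x / Nt = 2 * a ^ 2 := by rw [ha2]; field_simp
      rw [this]
      nlinarith
    have hne' : (Finset.univ.erase j).Nonempty := by
      refine ⟨⟨1, by omega⟩, ?_⟩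
      simp [j]
    have hcard : ((Finset.univ.erase j).card : ℝ) = Nt - 1 := by
      rw [Finset.card_erase_of_mem (Finset.mem_univ j), Finset.card_univ, Fintype.card_fin,
        Nat.cast_sub (by omega), Nat.cast_one]
    have hs0 := Finset.sum_pos (fun i hi => (hi' i hi).1) hne'
    have hs1 := Finset.sum_lt_sum_of_nonempty hne' fun i hi => (hi' i hi).2
    rw [Finset.sum_const, nsmul_eq_mul, hcard] at hs1
    have hs2 : ((Nt : ℝ) - 1) * (x / Nt) ≤ x := by
      rw [mul_div_assoc', div_le_iff₀ (by linarith)]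
      nlinarith
    have hn := Finset.sum_erase_add Finset.univ (fun i => ‖h i‖ ^ 2) (Finset.mem_univ j)
    rw [← EuclideanSpace.norm_sq_eq] at hn
    have hn1 : 1 < ‖h‖ ^ 2 := by linarith
    show 0 < distortion _ (shape h) ∧ distortion _ (shape h) < x
    rw [distortion_single_shape j hne]
    refine ⟨by positivity, ?_⟩
    rw [div_lt_iff₀ (by linarith)]
    nlinarith
  have hmS : MeasurableSet {h : EuclideanSpace ℂ (Fin Nt) |
      0 < distortion (EuclideanSpace.single j 1) (shape h) ∧
        distortion (EuclideanSpace.single j 1) (shape h) < x} :=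
    (measurable_distortion_shape _) (measurableSet_Ioo (a := 0) (b := x))
  rw [channelLaw, Measure.map_apply (by fun_prop) hmS]
  refine le_trans ?_ (measure_mono hsub)
  rw [Measure.pi_pi, ← Finset.mul_prod_erase Finset.univ _ (Finset.mem_univ j)]
  have hfac : ∀ i, ENNReal.ofReal (c * (hi i - lo i)) * ENNReal.ofReal (c * (hi i - lo i)) ≤
      complexGaussian {z : ℂ | z.re ∈ Set.Ioo (lo i) (hi i) ∧ z.im ∈ Set.Ioo (lo i) (hi i)} := by
    intro i
    rw [complexGaussian_rect measurableSet_Ioo measurableSet_Ioo]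
    have := hcI (lo i) (hi i) (by simp only [lo]; split_ifs <;> norm_num)
      (by simp only [lo, hi]; split_ifs <;> linarith)
      (by simp only [hi]; split_ifs <;> linarith)
    exact mul_le_mul' this this
  refine le_trans ?_ (mul_le_mul' (hfac j) (Finset.prod_le_prod' fun i _ => hfac i))
  have hconst : ∀ i ∈ Finset.univ.erase j,
      ENNReal.ofReal (c * (hi i - lo i)) * ENNReal.ofReal (c * (hi i - lo i)) =
        ENNReal.ofReal (c ^ 2 / (2 * Nt) * x) := by
    intro i hij
    simp only [lo, hi, if_neg (Finset.ne_of_mem_erase hij)]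
    rw [← ENNReal.ofReal_mul (by nlinarith)]
    congr 1
    calc c * (a - 0) * (c * (a - 0)) = c ^ 2 * a ^ 2 := by ring
      _ = _ := by rw [ha2]; ring
  rw [Finset.prod_congr rfl hconst, Finset.prod_const,
    Finset.card_erase_of_mem (Finset.mem_univ j), Finset.card_univ, Fintype.card_fin]
  simp only [lo, hi, if_true]
  rw [← ENNReal.ofReal_mul (by norm_num; linarith), ← ENNReal.ofReal_pow (by positivity),
    ← ENNReal.ofReal_mul (by norm_num; positivity)]
  refine ENNReal.ofReal_le_ofReal (le_of_eq ?_)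
  have : x ^ ((Nt : ℝ) - 1) = x ^ (Nt - 1) := by
    rw [← Real.rpow_natCast, Nat.cast_sub (by omega), Nat.cast_one]
  rw [this, mul_pow]
  ring

/-! ### Codebook geometry -/

theorem inner_codeVec_self_basis (W : Codebook Nt M) (m : Fin M) (n n' : Fin Nt) :
    inner ℂ (codeVec W m n) (codeVec W m n') = if n = n' then 1 else 0 := by
  have h := Matrix.mem_unitaryGroup_iff'.1 (W m).2
  have h2 := congrFun (congrFun h n) n'
  rw [Matrix.one_apply, Matrix.mul_apply] at h2
  rw [← h2, PiLp.inner_apply]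
  refine Finset.sum_congr rfl fun i _ => ?_
  simp [codeVec, Matrix.star_apply, mul_comm]

theorem norm_codeVec (W : Codebook Nt M) (m : Fin M) (n : Fin Nt) : ‖codeVec W m n‖ = 1 := by
  have h := inner_codeVec_self_basis W m n n
  have h2 := inner_self_eq_norm_sq (𝕜 := ℂ) (codeVec W m n)
  rw [h, if_pos rfl, RCLike.one_re] at h2
  nlinarith [norm_nonneg (codeVec W m n)]

/-- No vector of the basis `m` is parallel to another vector of the codebook. -/
def IsSeparated (W : Codebook Nt M) (m : Fin M) : Prop :=
  ∀ (n : Fin Nt) (p : Fin M × Fin Nt), p ≠ (m, n) →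
    ‖inner ℂ (codeVec W m n) (codeVec W p.1 p.2)‖ < 1

/-- Write `s = a • v + r` with `r` orthogonal to `v`. Then `‖r‖ ^ 2 ≤ 1 - ‖a‖ ^ 2`, which is the
distortion, and `‖inner ℂ v' s‖ ≤ ‖a‖ * g + ‖r‖`. It suffices that `‖r‖ < ‖a‖ * (1 - g)`; the
threshold gives this because it is at most `1 / 2`, which forces `‖a‖ ^ 2 ≥ 1 / 2`. -/
theorem distortion_lt_of_lt {v v' s : EuclideanSpace ℂ (Fin Nt)} (hv : ‖v‖ = 1) (hv' : ‖v'‖ = 1)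
    (hs : ‖s‖ ≤ 1) (hvv : ‖inner ℂ v v'‖ < 1)
    (hd : distortion v s < (1 - ‖inner ℂ v v'‖) ^ 2 / 2) : distortion v s < distortion v' s := by
  set g := ‖inner ℂ v v'‖ with hg
  set a : ℂ := inner ℂ v s with ha
  have hg0 : 0 ≤ g := norm_nonneg _
  have ha0 : 0 ≤ ‖a‖ := norm_nonneg _
  have hvs : inner ℂ v (s - a • v) = 0 := by
    rw [inner_sub_right, inner_smul_right, inner_self_eq_norm_sq_to_K, hv]
    simp [ha]
  have hpyth : ‖s‖ ^ 2 = ‖a‖ ^ 2 + ‖s - a • v‖ ^ 2 := by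
    have h0 : inner ℂ (a • v) (s - a • v) = 0 := by rw [inner_smul_left, hvs, mul_zero]
    have h1 := norm_add_sq_eq_norm_sq_add_norm_sq_of_inner_eq_zero _ _ h0
    rw [add_sub_cancel, norm_smul, hv, mul_one] at h1
    nlinarith
  have hb : ‖inner ℂ v' s‖ ≤ ‖a‖ * g + ‖s - a • v‖ := by
    have h1 : inner ℂ v' s = a * inner ℂ v' v + inner ℂ v' (s - a • v) := by
      rw [inner_sub_right, inner_smul_right]; ring
    rw [h1]
    refine (norm_add_le _ _).trans (add_le_add ?_ ?_)
    · rw [norm_mul, norm_inner_symm v' v]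
    · refine (norm_inner_le_norm _ _).trans ?_
      rw [hv', one_mul]
  have hd' : 1 - ‖a‖ ^ 2 < (1 - g) ^ 2 / 2 := hd
  have hlt : ‖s - a • v‖ < ‖a‖ * (1 - g) := by
    refine lt_of_pow_lt_pow_left₀ 2 (mul_nonneg ha0 (by linarith)) ?_
    have hs2 : ‖s‖ ^ 2 ≤ 1 := by nlinarith [norm_nonneg s]
    have hg2 : (1 - g) ^ 2 ≤ 1 := by nlinarith
    have : 1 / 2 ≤ ‖a‖ ^ 2 := by linarith
    rw [mul_pow]
    nlinarith [sq_nonneg (1 - g)]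
  have hfin : ‖inner ℂ v' s‖ < ‖a‖ := by linarith
  have := pow_lt_pow_left₀ hfin (norm_nonneg _) two_ne_zero
  simp only [distortion]
  linarith

/-! ### Quantization error and SINR -/

theorem quantError_nonneg (W : Codebook Nt M) (h : EuclideanSpace ℂ (Fin Nt)) :
    0 ≤ quantError W h :=
  Real.iInf_nonneg fun p => distortion_shape_nonneg (norm_codeVec W p.1 p.2) h

theorem quantError_le (W : Codebook Nt M) (h : EuclideanSpace ℂ (Fin Nt)) (p : Fin M × Fin Nt) :
    quantError W h ≤ distortion (codeVec W p.1 p.2) (shape h) :=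
  ciInf_le (Set.finite_range _).bddBelow p

theorem exists_quantError_eq [Nonempty (Fin M × Fin Nt)] (W : Codebook Nt M)
    (h : EuclideanSpace ℂ (Fin Nt)) :
    ∃ p : Fin M × Fin Nt, distortion (codeVec W p.1 p.2) (shape h) = quantError W h :=
  exists_eq_ciInf_of_finite

theorem log_one_add_sinr (W : Codebook Nt M) (h : EuclideanSpace ℂ (Fin Nt)) :
    Real.log (1 + sinr W h) = -Real.log (quantError W h) := by
  rw [sinr, add_sub_cancel, one_div, Real.log_inv]

theorem log_one_add_maxSinr_le (W : Codebook Nt M) (h : Fin U → EuclideanSpace ℂ (Fin Nt))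
    (m : Fin M) (n : Fin Nt) {B : ℝ} (hB : 0 ≤ B) (h' : ∀ u, -Real.log (quantError W (h u)) ≤ B) :
    Real.log (1 + maxSinr W h m n) ≤ B := by
  unfold maxSinr
  split_ifs with hne
  · obtain ⟨u, -, hu⟩ := Finset.exists_mem_eq_sup' hne fun u => sinr W (h u)
    rw [hu, log_one_add_sinr]
    exact h' u
  · simpa using hB

theorem log_one_add_maxSinr_nonneg [Nonempty (Fin M × Fin Nt)] (W : Codebook Nt M)
    (h : Fin U → EuclideanSpace ℂ (Fin Nt)) (m : Fin M) (n : Fin Nt) :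
    0 ≤ Real.log (1 + maxSinr W h m n) := by
  unfold maxSinr
  split_ifs with hne
  · obtain ⟨u, -, hu⟩ := Finset.exists_mem_eq_sup' hne fun u => sinr W (h u)
    obtain ⟨p, hp⟩ := exists_quantError_eq W (h u)
    rw [hu, log_one_add_sinr, Left.nonneg_neg_iff]
    exact Real.log_nonpos (quantError_nonneg _ _) (hp ▸ distortion_le_one _ _)
  · simp

theorem sum_log_le_sumRate (W : Codebook Nt M) (h : Fin U → EuclideanSpace ℂ (Fin Nt))
    (m : Fin M) : ∑ n : Fin Nt, Real.log (1 + maxSinr W h m n) ≤ sumRate W h :=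
  le_ciSup (f := fun m => ∑ n : Fin Nt, Real.log (1 + maxSinr W h m n))
    (Set.finite_range _).bddAbove m

theorem sumRate_nonneg [Nonempty (Fin M × Fin Nt)] (W : Codebook Nt M)
    (h : Fin U → EuclideanSpace ℂ (Fin Nt)) : 0 ≤ sumRate W h :=
  Real.iSup_nonneg fun m => Finset.sum_nonneg fun n _ => log_one_add_maxSinr_nonneg W h m n

/-- The sum over the codebook of the negative powers of the distortion. -/
def momentSum (lam : ℝ) (W : Codebook Nt M) (h : EuclideanSpace ℂ (Fin Nt)) : ℝ :=
  ∑ p : Fin M × Fin Nt, distortion (codeVec W p.1 p.2) (shape h) ^ (-lam)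

theorem momentSum_nonneg (lam : ℝ) (W : Codebook Nt M) (h : EuclideanSpace ℂ (Fin Nt)) :
    0 ≤ momentSum lam W h :=
  Finset.sum_nonneg fun p _ =>
    Real.rpow_nonneg (distortion_shape_nonneg (norm_codeVec W p.1 p.2) h) _

/-- The tangent to the logarithm at `K` gives `log y ≤ log K - 1 + y / K`, applied to `y = ε ^
(-lam)`. The right side is linear in the moment sum, so its mean is computable, and `K` stays free
to be tuned to the number of users. -/
theorem neg_log_quantError_le [Nonempty (Fin M × Fin Nt)] (W : Codebook Nt M)
    (h : EuclideanSpace ℂ (Fin Nt)) {lam K : ℝ} (hl : 0 < lam) (hK : Real.exp 1 ≤ K) :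
    -Real.log (quantError W h) ≤ (Real.log K - 1 + momentSum lam W h / K) / lam := by
  have hK0 : 0 < K := (Real.exp_pos 1).trans_le hK
  have hK1 : 1 ≤ Real.log K := (Real.le_log_iff_exp_le hK0).2 hK
  have hS := momentSum_nonneg lam W h
  rcases (quantError_nonneg W h).eq_or_lt with h0 | h0
  -- For zero error the convention `log 0 = 0` applies; `exp 1 ≤ K` keeps the right side
  -- nonnegative.
  · rw [← h0, Real.log_zero, neg_zero]
    have : 0 ≤ Real.log K - 1 := by linarith
    positivity
  · obtain ⟨p, hp⟩ := exists_quantError_eq W h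
    have h1 : quantError W h ^ (-lam) ≤ momentSum lam W h := by
      rw [← hp]
      exact Finset.single_le_sum (f := fun p : Fin M × Fin Nt =>
        distortion (codeVec W p.1 p.2) (shape h) ^ (-lam)) (fun p _ =>
        Real.rpow_nonneg (distortion_shape_nonneg (norm_codeVec W p.1 p.2) h) _)
        (Finset.mem_univ p)
    have hy : 0 < quantError W h ^ (-lam) := Real.rpow_pos_of_pos h0 _
    have h2 := Real.log_le_sub_one_of_pos (div_pos hy hK0)
    rw [Real.log_div hy.ne' hK0.ne', Real.log_rpow h0] at h2
    have h3 : quantError W h ^ (-lam) / K ≤ momentSum lam W h / K := by gcongr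
    rw [le_div_iff₀ hl]
    linarith

theorem sumRate_le [Nonempty (Fin M × Fin Nt)] (W : Codebook Nt M)
    (h : Fin U → EuclideanSpace ℂ (Fin Nt)) {lam K : ℝ} (hl : 0 < lam) (hK : Real.exp 1 ≤ K) :
    sumRate W h ≤ Nt * ((Real.log K - 1 + ∑ u, momentSum lam W (h u) / K) / lam) := by
  have hK0 : 0 < K := (Real.exp_pos 1).trans_le hK
  have hK1 : 1 ≤ Real.log K := (Real.le_log_iff_exp_le hK0).2 hK
  have hpos : ∀ u, 0 ≤ momentSum lam W (h u) / K := fun u =>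
    div_nonneg (momentSum_nonneg _ _ _) hK0.le
  have hB : 0 ≤ (Real.log K - 1 + ∑ u, momentSum lam W (h u) / K) / lam :=
    div_nonneg (add_nonneg (by linarith) (Finset.sum_nonneg fun u _ => hpos u)) hl.le
  have : Nonempty (Fin M) := (inferInstance : Nonempty (Fin M × Fin Nt)).map Prod.fst
  refine ciSup_le fun m => ?_
  refine (Finset.sum_le_card_nsmul _ _ _ fun n _ =>
    log_one_add_maxSinr_le W h m n hB fun u => ?_).trans_eq (by simp)
  refine (neg_log_quantError_le W (h u) hl hK).trans ?_
  gcongr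
  exact Finset.single_le_sum (f := fun u => momentSum lam W (h u) / K) (fun u _ => hpos u)
    (Finset.mem_univ u)

theorem le_log_one_add_maxSinr [Nonempty (Fin M × Fin Nt)] (W : Codebook Nt M)
    (h : Fin U → EuclideanSpace ℂ (Fin Nt)) (m : Fin M) (n : Fin Nt) {x : ℝ} (u : Fin U)
    (hu0 : 0 < distortion (codeVec W m n) (shape (h u)))
    (hux : distortion (codeVec W m n) (shape (h u)) < x)
    (hclose : ∀ p : Fin M × Fin Nt, p ≠ (m, n) →
      distortion (codeVec W m n) (shape (h u)) < distortion (codeVec W p.1 p.2) (shape (h u))) :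
    -Real.log x ≤ Real.log (1 + maxSinr W h m n) := by
  have hmem : u ∈ userSet W h m n := by
    simp only [userSet, Finset.mem_filter, Finset.mem_univ, true_and]
    intro m' n' hne
    refine hclose (m', n') fun hp => hne ?_
    rw [Prod.mk.injEq] at hp
    rw [hp.1, hp.2]
  have hne : (userSet W h m n).Nonempty := ⟨u, hmem⟩
  have hle : sinr W (h u) ≤ maxSinr W h m n := by
    rw [maxSinr, dif_pos hne]
    exact Finset.le_sup' (fun u => sinr W (h u)) hmem
  -- Positivity rules out the convention `1 / 0 = 0`, under which a perfectly quantized user would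
  -- have SINR `-1`.
  have hq : 0 < quantError W (h u) := by
    obtain ⟨p, hp⟩ := exists_quantError_eq W (h u)
    rw [← hp]
    by_cases hpe : p = (m, n)
    · rw [hpe]; exact hu0
    · exact hu0.trans (hclose p hpe)
  have hqx : quantError W (h u) ≤ x := (quantError_le W (h u) (m, n)).trans hux.le
  have h1 : -Real.log x ≤ Real.log (1 + sinr W (h u)) := by
    rw [log_one_add_sinr]
    exact neg_le_neg (Real.log_le_log hq hqx)
  refine h1.trans (Real.log_le_log ?_ (by linarith))
  rw [sinr, add_sub_cancel]
  positivity

theorem IsSeparated.exists_radius [Nonempty (Fin M × Fin Nt)] {W : Codebook Nt M} {m : Fin M}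
    (hW : IsSeparated W m) :
    ∃ r : ℝ, 0 < r ∧ ∀ x ≤ r, ∀ (U : ℕ) (h : Fin U → EuclideanSpace ℂ (Fin Nt)) (n : Fin Nt),
      (∃ u, 0 < distortion (codeVec W m n) (shape (h u)) ∧
        distortion (codeVec W m n) (shape (h u)) < x) →
      -Real.log x ≤ Real.log (1 + maxSinr W h m n) := by
  have hev : ∀ᶠ r : ℝ in 𝓝[>] 0, ∀ (n : Fin Nt) (p : Fin M × Fin Nt), p ≠ (m, n) →
      r < (1 - ‖inner ℂ (codeVec W m n) (codeVec W p.1 p.2)‖) ^ 2 / 2 := by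
    simp only [eventually_all]
    intro n p hp
    have h1 := hW n p hp
    have h2 : 0 < (1 - ‖inner ℂ (codeVec W m n) (codeVec W p.1 p.2)‖) ^ 2 / 2 := by
      have : 0 < 1 - ‖inner ℂ (codeVec W m n) (codeVec W p.1 p.2)‖ := by linarith
      positivity
    exact nhdsWithin_le_nhds (eventually_lt_nhds h2)
  obtain ⟨r, hr, hr0⟩ := (hev.and self_mem_nhdsWithin).exists
  refine ⟨r, hr0, fun x hx U h n ⟨u, hu0, hux⟩ => ?_⟩
  refine le_log_one_add_maxSinr W h m n u hu0 hux fun p hp => ?_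
  exact distortion_lt_of_lt (norm_codeVec _ _ _) (norm_codeVec _ _ _) (norm_shape_le _)
    (hW n p hp) ((hux.trans_le hx).trans (hr n p hp))

/-! ### Measurability of the sum rate -/

theorem measurable_codeVec (m : Fin M) (n : Fin Nt) :
    Measurable fun W : Codebook Nt M => codeVec W m n := by
  unfold codeVec
  refine (WithLp.measurable_toLp 2 _).comp (measurable_pi_lambda _ fun i => ?_)
  have hc : Continuous fun A : Matrix.unitaryGroup (Fin Nt) ℂ =>
      (A : Matrix (Fin Nt) (Fin Nt) ℂ) i n :=
    (continuous_apply n).comp ((continuous_apply i).comp continuous_subtype_val)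
  exact hc.measurable.comp (measurable_pi_apply m)

theorem measurable_distortion (m : Fin M) (n : Fin Nt) (u : Fin U) :
    Measurable fun x : Codebook Nt M × (Fin U → EuclideanSpace ℂ (Fin Nt)) =>
      distortion (codeVec x.1 m n) (shape (x.2 u)) := by
  have h1 : Measurable fun x : Codebook Nt M × (Fin U → EuclideanSpace ℂ (Fin Nt)) =>
      codeVec x.1 m n := (measurable_codeVec m n).comp measurable_fst
  have h2 : Measurable fun x : Codebook Nt M × (Fin U → EuclideanSpace ℂ (Fin Nt)) =>
      shape (x.2 u) := measurable_shape.comp ((measurable_pi_apply u).comp measurable_snd)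
  exact ((h1.inner h2).norm.pow_const 2).const_sub 1

theorem measurable_sinr (u : Fin U) :
    Measurable fun x : Codebook Nt M × (Fin U → EuclideanSpace ℂ (Fin Nt)) =>
      sinr x.1 (x.2 u) := by
  unfold sinr quantError
  exact ((Measurable.iInf fun p : Fin M × Fin Nt =>
    measurable_distortion p.1 p.2 u).const_div 1).sub_const 1

theorem measurableSet_mem_userSet (m : Fin M) (n : Fin Nt) (u : Fin U) :
    MeasurableSet {x : Codebook Nt M × (Fin U → EuclideanSpace ℂ (Fin Nt)) |
      u ∈ userSet x.1 x.2 m n} := by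
  simp only [userSet, Finset.mem_filter, Finset.mem_univ, true_and, Set.ofPred_forall]
  refine MeasurableSet.iInter fun m' => MeasurableSet.iInter fun n' => ?_
  refine MeasurableSet.imp (MeasurableSet.compl ?_)
    (measurableSet_lt (measurable_distortion m n u) (measurable_distortion m' n' u))
  exact measurableSet_eq_fun ((measurable_codeVec m' n').comp measurable_fst)
    ((measurable_codeVec m n).comp measurable_fst)

/-- The user set takes finitely many values; on each of these measurable events the maximum runs
over a fixed set of users. -/
theorem measurable_maxSinr (m : Fin M) (n : Fin Nt) :
    Measurable fun x : Codebook Nt M × (Fin U → EuclideanSpace ℂ (Fin Nt)) =>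
      maxSinr x.1 x.2 m n := by
  classical
  have hA : ∀ A : Finset (Fin U), MeasurableSet
      {x : Codebook Nt M × (Fin U → EuclideanSpace ℂ (Fin Nt)) | userSet x.1 x.2 m n = A} := by
    intro A
    simp only [Finset.ext_iff, Set.ofPred_forall]
    exact MeasurableSet.iInter fun u =>
      (measurableSet_mem_userSet m n u).iff (MeasurableSet.const _)
  let f : Finset (Fin U) → Codebook Nt M × (Fin U → EuclideanSpace ℂ (Fin Nt)) → ℝ := fun A x =>
    if hne : A.Nonempty then A.sup' hne fun u => sinr x.1 (x.2 u) else 0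
  have hf : ∀ A, Measurable (f A) := by
    intro A
    by_cases hne : A.Nonempty
    · simp only [f, dif_pos hne]
      have h := Finset.measurable_sup' hne
        (f := fun u (x : Codebook Nt M × (Fin U → EuclideanSpace ℂ (Fin Nt))) =>
          sinr x.1 (x.2 u)) fun u _ => measurable_sinr u
      convert h using 1
      ext x
      rw [Finset.sup'_apply]
    · simp only [f, dif_neg hne]
      exact measurable_const
  have heq : (fun x : Codebook Nt M × (Fin U → EuclideanSpace ℂ (Fin Nt)) =>
      maxSinr x.1 x.2 m n) = fun x => ∑ A : Finset (Fin U),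
        Set.indicator {x | userSet x.1 x.2 m n = A} (f A) x := by
    ext x
    simp only [Set.indicator_apply, Set.mem_ofPred_eq, Finset.sum_ite_eq, Finset.mem_univ, if_true]
    rfl
  rw [heq]
  exact Finset.measurable_sum _ fun A _ => (hf A).indicator (hA A)

theorem measurable_sumRate :
    Measurable fun x : Codebook Nt M × (Fin U → EuclideanSpace ℂ (Fin Nt)) =>
      sumRate x.1 x.2 := by
  unfold sumRate
  exact Measurable.iSup fun m => Finset.measurable_sum _ fun n _ =>
    Real.measurable_log.comp ((measurable_maxSinr m n).const_add 1)

/-! ### Random codebooks have no parallel vectors -/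

instance : IsProbabilityMeasure (haarUnitary Nt) :=
  ⟨by rw [haarUnitary]; exact Measure.haarMeasure_self (K₀ := ⊤)⟩

instance : (haarUnitary Nt).IsMulLeftInvariant := by
  unfold haarUnitary; infer_instance

instance : IsProbabilityMeasure (codebookLaw Nt M) := by
  unfold codebookLaw; infer_instance

/-- The `n`-th column of a unitary matrix. -/
def column (A : Matrix.unitaryGroup (Fin Nt) ℂ) (n : Fin Nt) : EuclideanSpace ℂ (Fin Nt) :=
  WithLp.toLp 2 fun i => (A : Matrix (Fin Nt) (Fin Nt) ℂ) i n

theorem norm_column (A : Matrix.unitaryGroup (Fin Nt) ℂ) (n : Fin Nt) : ‖column A n‖ = 1 :=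
  norm_codeVec (fun _ : Fin 1 => A) 0 n

theorem measurable_column (n : Fin Nt) :
    Measurable fun A : Matrix.unitaryGroup (Fin Nt) ℂ => column A n :=
  (measurable_codeVec (M := 1) 0 n).comp (measurable_pi_lambda (fun A _ => A) fun _ => measurable_id)

theorem exists_unitary_column_mul
    (T : EuclideanSpace ℂ (Fin Nt) ≃ₗᵢ[ℂ] EuclideanSpace ℂ (Fin Nt)) :
    ∃ g : Matrix.unitaryGroup (Fin Nt) ℂ, ∀ A n, column (g * A) n = T (column A n) := by
  let G : Matrix (Fin Nt) (Fin Nt) ℂ := fun i k => T (EuclideanSpace.single k 1) i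
  have hG : G ∈ Matrix.unitaryGroup (Fin Nt) ℂ := by
    rw [Matrix.mem_unitaryGroup_iff']
    ext k l
    have h := T.inner_map_map (EuclideanSpace.single k (1 : ℂ)) (EuclideanSpace.single l (1 : ℂ))
    rw [PiLp.inner_apply, EuclideanSpace.inner_single_left] at h
    rw [Matrix.mul_apply, Matrix.one_apply]
    simp only [G]
    simp only [RCLike.inner_apply', map_one, one_mul, PiLp.single_apply] at h
    exact h
  refine ⟨⟨G, hG⟩, fun A n => ?_⟩
  have hsum : column A n =
      ∑ k, (A : Matrix (Fin Nt) (Fin Nt) ℂ) k n • EuclideanSpace.single k (1 : ℂ) := by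
    ext i
    simp [column, Pi.single_apply]
  rw [hsum, map_sum]
  ext i
  have hmul : column (⟨G, hG⟩ * A) n i = ∑ k, G i k * (A : Matrix (Fin Nt) (Fin Nt) ℂ) k n :=
    Matrix.mul_apply
  rw [hmul]
  simp [G, mul_comm]

theorem exists_isometry_map_eq {v w : EuclideanSpace ℂ (Fin Nt)} (hv : ‖v‖ = 1) (hw : ‖w‖ = 1)
    (j : Fin Nt) : ∃ T : EuclideanSpace ℂ (Fin Nt) ≃ₗᵢ[ℂ] EuclideanSpace ℂ (Fin Nt), T v = w := by
  obtain ⟨T, hT⟩ := exists_isometry_map_eq_single v hv j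
  obtain ⟨T', hT'⟩ := exists_isometry_map_eq_single w hw j
  exact ⟨T.trans T'.symm, by simp [hT, ← hT']⟩

theorem measurableSet_column_parallel (n : Fin Nt) (v : EuclideanSpace ℂ (Fin Nt)) :
    MeasurableSet {A : Matrix.unitaryGroup (Fin Nt) ℂ | ‖inner ℂ v (column A n)‖ = 1} :=
  measurableSet_eq_fun (measurable_const.inner (measurable_column n)).norm measurable_const

theorem haarUnitary_column_parallel_eq (n : Fin Nt) {v w : EuclideanSpace ℂ (Fin Nt)}
    (hv : ‖v‖ = 1) (hw : ‖w‖ = 1) :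
    haarUnitary Nt {A | ‖inner ℂ v (column A n)‖ = 1} =
      haarUnitary Nt {A | ‖inner ℂ w (column A n)‖ = 1} := by
  obtain ⟨T, hT⟩ := exists_isometry_map_eq hv hw n
  obtain ⟨g, hg⟩ := exists_unitary_column_mul T
  rw [← measure_preimage_mul (haarUnitary Nt) g {A | ‖inner ℂ w (column A n)‖ = 1}]
  congr 1
  ext A
  simp only [Set.mem_preimage, Set.mem_ofPred_eq, hg, ← hT, T.inner_map_map]

/-- Unit vectors with pairwise distinct directions. -/
theorem exists_pairwise_nonparallel (hNt : 2 ≤ Nt) :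
    ∃ w : ℕ → EuclideanSpace ℂ (Fin Nt), (∀ k, ‖w k‖ = 1) ∧
      ∀ k l (x : EuclideanSpace ℂ (Fin Nt)), ‖x‖ = 1 → ‖inner ℂ (w k) x‖ = 1 →
        ‖inner ℂ (w l) x‖ = 1 → k = l := by
  let j0 : Fin Nt := ⟨0, by omega⟩
  let j1 : Fin Nt := ⟨1, by omega⟩
  have hj : j0 ≠ j1 := by simp [j0, j1]
  -- The ratio of the two coordinates is `k`, so distinct `k` give distinct complex lines.
  let y : ℕ → EuclideanSpace ℂ (Fin Nt) := fun k =>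
    EuclideanSpace.single j0 1 + EuclideanSpace.single j1 (k : ℂ)
  have y0 : ∀ k, y k j0 = 1 := fun k => by simp [y, hj]
  have y1 : ∀ k, y k j1 = k := fun k => by simp [y, hj.symm]
  have hy : ∀ k, y k ≠ 0 := fun k h => by
    have := y0 k
    rw [h] at this
    simp at this
  refine ⟨fun k => shape (y k), fun k => norm_shape (hy k), fun k l x hx hk hl => ?_⟩
  have hpar : ∀ k, ‖inner ℂ (shape (y k)) x‖ = 1 → ∃ c : ℂ, x = c • y k := by
    intro k hk
    have h1 : ‖inner ℂ (y k) x‖ = ‖y k‖ * ‖x‖ := by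
      rw [shape, inner_smul_left, norm_mul] at hk
      simp only [Complex.conj_ofReal, Complex.norm_real, norm_inv, norm_norm] at hk
      have := norm_ne_zero_iff.2 (hy k)
      rw [hx, mul_one]
      field_simp at hk
      exact hk
    have hx0 : x ≠ 0 := by
      rintro rfl
      simp at hx
    obtain ⟨r, -, hr⟩ := (norm_inner_eq_norm_iff (hy k) hx0).1 h1
    exact ⟨r, hr⟩
  obtain ⟨c, hc⟩ := hpar k hk
  obtain ⟨d, hd⟩ := hpar l hl
  have e0 : x j0 = c := by rw [hc, PiLp.smul_apply, y0]; simp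
  have e0' : x j0 = d := by rw [hd, PiLp.smul_apply, y0]; simp
  have e1 : x j1 = c * k := by rw [hc, PiLp.smul_apply, y1, smul_eq_mul]
  have e1' : x j1 = d * l := by rw [hd, PiLp.smul_apply, y1, smul_eq_mul]
  have hc0 : c ≠ 0 := by
    rintro rfl
    rw [hc, zero_smul] at hx
    simp at hx
  rw [← e0', e0, e1] at e1'
  exact_mod_cast mul_left_cancel₀ hc0 e1'

/-- By left invariance all directions have the same probability. Infinitely many distinct directions
give disjoint events, so in a probability space the common value is 0. -/
theorem haarUnitary_column_parallel (hNt : 2 ≤ Nt) (n : Fin Nt) {v : EuclideanSpace ℂ (Fin Nt)}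
    (hv : ‖v‖ = 1) : haarUnitary Nt {A | ‖inner ℂ v (column A n)‖ = 1} = 0 := by
  obtain ⟨w, hw, hdisj⟩ := exists_pairwise_nonparallel hNt
  by_contra hne
  have hfin := Measure.finite_const_le_meas_of_disjoint_iUnion (haarUnitary Nt)
    (pos_iff_ne_zero.2 hne)
    (As := fun k : ℕ => {A | ‖inner ℂ (w k) (column A n)‖ = 1})
    (fun k => measurableSet_column_parallel n (w k))
    (fun k l hkl => Set.disjoint_left.2 fun A hk hl =>
      hkl (hdisj k l _ (norm_column A n) hk hl))
    (measure_ne_top _ _)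
  refine Set.infinite_univ (α := ℕ) (hfin.subset fun k _ => ?_)
  exact (haarUnitary_column_parallel_eq n hv (hw k)).le

theorem ae_codebookLaw_not_parallel (hNt : 2 ≤ Nt) {m m' : Fin M} (hm : m ≠ m') (n n' : Fin Nt) :
    ∀ᵐ W ∂(codebookLaw Nt M), ‖inner ℂ (codeVec W m n) (codeVec W m' n')‖ ≠ 1 := by
  have hind : iIndepFun (fun (i : Fin M) (W : Codebook Nt M) => W i) (codebookLaw Nt M) :=
    iIndepFun_pi (X := fun _ A => A) fun _ => aemeasurable_id
  have hpair := (indepFun_iff_map_prod_eq_prod_map_map (measurable_pi_apply m).aemeasurable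
    (measurable_pi_apply m').aemeasurable).1 (hind.indepFun hm)
  have hev : ∀ i : Fin M, (codebookLaw Nt M).map (fun W => W i) = haarUnitary Nt := fun i =>
    (measurePreserving_eval (fun _ : Fin M => haarUnitary Nt) i).map_eq
  rw [hev, hev] at hpair
  have hS : MeasurableSet {q : Matrix.unitaryGroup (Fin Nt) ℂ × Matrix.unitaryGroup (Fin Nt) ℂ |
      ‖inner ℂ (column q.1 n) (column q.2 n')‖ = 1} :=
    measurableSet_eq_fun (((measurable_column n).comp measurable_fst).inner
      ((measurable_column n').comp measurable_snd)).norm measurable_const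
  have hnull : (haarUnitary Nt).prod (haarUnitary Nt)
      {q | ‖inner ℂ (column q.1 n) (column q.2 n')‖ = 1} = 0 := by
    rw [Measure.measure_prod_null hS]
    refine ae_of_all _ fun A => ?_
    have h := haarUnitary_column_parallel hNt n' (norm_column A n)
    exact h
  have hm2 : Measurable fun W : Codebook Nt M => (W m, W m') := by fun_prop
  rw [← hpair] at hnull
  have h0 := measure_eq_zero_iff_ae_notMem.1 hnull
  exact ae_of_ae_map hm2.aemeasurable h0

theorem ae_isSeparated (hNt : 2 ≤ Nt) (m : Fin M) :
    ∀ᵐ W ∂(codebookLaw Nt M), IsSeparated W m := by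
  have h : ∀ᵐ W ∂(codebookLaw Nt M), ∀ m', m ≠ m' → ∀ n n',
      ‖inner ℂ (codeVec W m n) (codeVec W m' n')‖ ≠ 1 := by
    simp only [ae_all_iff]
    exact fun m' hm n n' => ae_codebookLaw_not_parallel hNt hm n n'
  filter_upwards [h] with W hW n ⟨m', n'⟩ hp
  by_cases hm : m = m'
  · subst hm
    have hn : n ≠ n' := fun hn => hp (by rw [hn])
    simp only
    rw [inner_codeVec_self_basis, if_neg hn]
    simp
  · refine lt_of_le_of_ne ?_ (hW m' hm n n')
    refine (norm_inner_le_norm _ _).trans ?_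
    rw [norm_codeVec, norm_codeVec, one_mul]

/-! ### Bounds for the throughput with a fixed codebook -/

theorem measurable_sumRate_codebook (W : Codebook Nt M) :
    Measurable fun h : Fin U → EuclideanSpace ℂ (Fin Nt) => sumRate W h := by
  have h1 := measurable_sumRate (Nt := Nt) (M := M) (U := U)
  exact Measurable.of_uncurry_left (f := fun W h => sumRate W h) h1

theorem measurePreserving_channel (u : Fin U) :
    MeasurePreserving (fun h : Fin U → EuclideanSpace ℂ (Fin Nt) => h u)
      (channelsLaw Nt U) (channelLaw Nt) :=
  measurePreserving_eval (fun _ : Fin U => channelLaw Nt) u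

theorem exists_momentSum_integral (M : ℕ) (hNt : 2 ≤ Nt) {lam : ℝ} (hl : 0 ≤ lam)
    (hl' : lam < Nt - 1) :
    ∃ D : ℝ, 0 ≤ D ∧ ∀ (W : Codebook Nt M) (U : ℕ) (u : Fin U),
      Integrable (fun h : Fin U → EuclideanSpace ℂ (Fin Nt) => momentSum lam W (h u))
        (channelsLaw Nt U) ∧
      ∫ h, momentSum lam W (h u) ∂(channelsLaw Nt U) = D := by
  obtain ⟨C, hC, hCv⟩ := exists_distortion_moment hNt hl hl'
  refine ⟨Fintype.card (Fin M × Fin Nt) * C, by positivity, fun W U u => ?_⟩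
  have hp := fun p : Fin M × Fin Nt => hCv _ (norm_codeVec W p.1 p.2)
  have hS : Integrable (momentSum lam W) (channelLaw Nt) :=
    integrable_finsetSum _ fun p _ => (hp p).1
  refine ⟨(measurePreserving_channel u).integrable_comp_of_integrable hS, ?_⟩
  have hmap := (measurePreserving_channel (Nt := Nt) u).map_eq
  have h1 := integral_map (μ := channelsLaw Nt U) (f := momentSum lam W)
    (measurePreserving_channel (Nt := Nt) u).measurable.aemeasurable
    (hmap ▸ hS.aestronglyMeasurable)
  rw [← h1, hmap]
  unfold momentSum
  rw [integral_finsetSum _ fun p _ => (hp p).1, Finset.sum_congr rfl fun p _ => (hp p).2,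
    Finset.sum_const, nsmul_eq_mul, Finset.card_univ]

/-- The constant depends neither on the codebook nor on `U`, so the bound serves both as the sharp
upper estimate and as a majorant over random codebooks. -/
theorem exists_codebookThroughput_le (hNt : 2 ≤ Nt) (hM : 1 ≤ M) {lam : ℝ} (hl : 0 < lam)
    (hl' : lam < Nt - 1) :
    ∃ K : ℝ, 0 < K ∧ ∀ (W : Codebook Nt M) (U : ℕ),
      Integrable (fun h : Fin U → EuclideanSpace ℂ (Fin Nt) => sumRate W h) (channelsLaw Nt U) ∧
      codebookThroughput W U ≤ Nt / lam * (Real.log (max U 1 : ℕ) + Real.log K) := by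
  have : Nonempty (Fin M × Fin Nt) := ⟨(⟨0, by omega⟩, ⟨0, by omega⟩)⟩
  obtain ⟨D, hD0, hSu'⟩ := exists_momentSum_integral M hNt hl.le hl'
  have hK0 : 0 < D + Real.exp 1 := by positivity
  refine ⟨D + Real.exp 1, hK0, fun W U => ?_⟩
  have hSu := hSu' W U
  set V : ℝ := ((max U 1 : ℕ) : ℝ) with hV
  have hV1 : 1 ≤ V := by rw [hV]; exact_mod_cast le_max_right U 1
  have hUV : (U : ℝ) ≤ V := by rw [hV]; exact_mod_cast le_max_left U 1
  -- With this tangent point the summed moments contribute `U * D / K ≤ 1`, cancelling the `-1`.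
  -- Using `max U 1` keeps `exp 1 ≤ K` when `U = 0`.
  set K : ℝ := V * (D + Real.exp 1) with hK
  have hKpos : 0 < K := by positivity
  have hKe : Real.exp 1 ≤ K := by nlinarith [Real.exp_pos 1]
  have hbound := fun h : Fin U → EuclideanSpace ℂ (Fin Nt) => sumRate_le W h hl hKe
  have hsum : Integrable (fun h : Fin U → EuclideanSpace ℂ (Fin Nt) =>
      ∑ u, momentSum lam W (h u) / K) (channelsLaw Nt U) :=
    integrable_finsetSum _ fun u _ => (hSu u).1.div_const K
  have hBint : Integrable (fun h : Fin U → EuclideanSpace ℂ (Fin Nt) =>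
      Nt * ((Real.log K - 1 + ∑ u, momentSum lam W (h u) / K) / lam)) (channelsLaw Nt U) :=
    (((integrable_const _).add hsum).div_const lam).const_mul _
  have hint : Integrable (fun h : Fin U → EuclideanSpace ℂ (Fin Nt) => sumRate W h)
      (channelsLaw Nt U) := by
    refine hBint.mono' (measurable_sumRate_codebook W).aestronglyMeasurable
      (ae_of_all _ fun h => ?_)
    rw [Real.norm_of_nonneg (sumRate_nonneg W h)]
    exact hbound h
  refine ⟨hint, (integral_mono hint hBint hbound).trans ?_⟩
  rw [integral_const_mul, integral_div, integral_add (integrable_const _) hsum,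
    integral_finsetSum _ fun u _ => (hSu u).1.div_const K]
  simp only [integral_div, (hSu _).2, integral_const, probReal_univ, one_smul, Finset.sum_const,
    Finset.card_univ, Fintype.card_fin, nsmul_eq_mul]
  have h1 : (U : ℝ) * (D / K) ≤ 1 := by
    rw [mul_div_assoc', div_le_one hKpos]
    nlinarith [Real.exp_pos 1]
  have h2 : Real.log K = Real.log V + Real.log (D + Real.exp 1) :=
    Real.log_mul (by positivity) hK0.ne'
  rw [div_mul_eq_mul_div, mul_div_assoc]
  refine mul_le_mul_of_nonneg_left (div_le_div_of_nonneg_right ?_ hl.le) (Nat.cast_nonneg _)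
  rw [← h2]
  linarith

theorem channelsLaw_exists_ge {B : Set (EuclideanSpace ℂ (Fin Nt))} (hB : MeasurableSet B) {q : ℝ}
    (hq : ENNReal.ofReal q ≤ channelLaw Nt B) :
    1 - Real.exp (-(q * U)) ≤ (channelsLaw Nt U).real {h | ∃ u, h u ∈ B} := by
  have hq' : q ≤ (channelLaw Nt).real B :=
    (ENNReal.ofReal_le_iff_le_toReal (measure_ne_top _ _)).1 hq
  have hset : {h : Fin U → EuclideanSpace ℂ (Fin Nt) | ∃ u, h u ∈ B} =
      (Set.pi Set.univ fun _ => Bᶜ)ᶜ := by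
    ext h; simp
  rw [hset, probReal_compl_eq_one_sub (MeasurableSet.univ_pi fun _ => hB.compl)]
  have hpi : (channelsLaw Nt U).real (Set.pi Set.univ fun _ => Bᶜ) =
      (1 - (channelLaw Nt).real B) ^ U := by
    rw [measureReal_def, channelsLaw, Measure.pi_pi, Finset.prod_const, Finset.card_univ,
      Fintype.card_fin, ENNReal.toReal_pow, ← measureReal_def, probReal_compl_eq_one_sub hB]
  rw [hpi]
  have h1 : (1 - (channelLaw Nt).real B) ^ U ≤ Real.exp (-q) ^ U := by
    refine pow_le_pow_left₀ ?_ ?_ U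
    · linarith [measureReal_le_one (μ := channelLaw Nt) (s := B)]
    · linarith [Real.one_sub_le_exp_neg q]
  rw [← Real.exp_nat_mul, show (U : ℝ) * -q = -(q * U) by ring] at h1
  linarith

/-- Each beam contributes at least `-log x` on the event that some user falls in its ball. Linearity
of the mean suffices, so the dependence between beams is irrelevant. -/
theorem IsSeparated.exists_le_codebookThroughput (hNt : 2 ≤ Nt) (hM : 1 ≤ M) {W : Codebook Nt M}
    {m : Fin M} (hW : IsSeparated W m) :
    ∃ c : ℝ, 0 < c ∧ ∃ r : ℝ, 0 < r ∧ ∀ x, 0 < x → x ≤ r → ∀ U : ℕ,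
      Nt * (-Real.log x * (1 - Real.exp (-(c * x ^ ((Nt : ℝ) - 1) * U)))) ≤
        codebookThroughput W U := by
  have : Nonempty (Fin M × Fin Nt) := ⟨(⟨0, by omega⟩, ⟨0, by omega⟩)⟩
  obtain ⟨c, hc, hball⟩ := exists_distortion_small_ball hNt
  obtain ⟨r, hr, hlow⟩ := hW.exists_radius
  have hN2 : (2 : ℝ) ≤ Nt := by exact_mod_cast hNt
  obtain ⟨K, -, hK⟩ := exists_codebookThroughput_le (M := M) hNt hM (lam := 1 / 2) (by norm_num)
    (by linarith)
  refine ⟨c, hc, min r 1, by positivity, fun x hx hxr U => ?_⟩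
  have hx1 : x ≤ 1 := hxr.trans (min_le_right _ _)
  have hL : 0 ≤ -Real.log x := by linarith [Real.log_nonpos hx.le hx1]
  let B : Fin Nt → Set (EuclideanSpace ℂ (Fin Nt)) := fun n =>
    {h | 0 < distortion (codeVec W m n) (shape h) ∧ distortion (codeVec W m n) (shape h) < x}
  have hB : ∀ n, MeasurableSet (B n) := fun n =>
    measurable_distortion_shape (codeVec W m n) (measurableSet_Ioo (a := 0) (b := x))
  let G : Fin Nt → Set (Fin U → EuclideanSpace ℂ (Fin Nt)) := fun n => {h | ∃ u, h u ∈ B n}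
  have hG : ∀ n, MeasurableSet (G n) := fun n => by
    simp only [G, Set.ofPred_exists]
    exact MeasurableSet.iUnion fun u => measurable_pi_apply u (hB n)
  have hGi : ∀ n, Integrable ((G n).indicator fun _ => -Real.log x) (channelsLaw Nt U) := fun n =>
    (integrable_const _).indicator (hG n)
  have hpt : ∀ h : Fin U → EuclideanSpace ℂ (Fin Nt),
      ∑ n, (G n).indicator (fun _ => -Real.log x) h ≤ sumRate W h := by
    intro h
    refine (Finset.sum_le_sum fun n _ => ?_).trans (sum_log_le_sumRate W h m)
    by_cases hn : h ∈ G n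
    · rw [Set.indicator_of_mem hn]
      exact hlow x (hxr.trans (min_le_left _ _)) U h n hn
    · rw [Set.indicator_of_notMem hn]
      exact log_one_add_maxSinr_nonneg W h m n
  refine le_trans ?_ (integral_mono (integrable_finsetSum _ fun n _ => hGi n) (hK W U).1 hpt)
  rw [integral_finsetSum _ fun n _ => hGi n]
  have hterm : ∀ n, -Real.log x * (1 - Real.exp (-(c * x ^ ((Nt : ℝ) - 1) * U))) ≤
      ∫ h, (G n).indicator (fun _ => -Real.log x) h ∂(channelsLaw Nt U) := by
    intro n
    rw [integral_indicator_const _ (hG n), smul_eq_mul, mul_comm]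
    refine mul_le_mul_of_nonneg_right ?_ hL
    exact channelsLaw_exists_ge (hB n) (hball _ (norm_codeVec W m n) x hx hx1)
  calc _ = ∑ _n : Fin Nt, -Real.log x * (1 - Real.exp (-(c * x ^ ((Nt : ℝ) - 1) * U))) := by
        simp
    _ ≤ _ := Finset.sum_le_sum fun n _ => hterm n

/-! ### Asymptotics -/

theorem tendsto_log_natCast_atTop : Tendsto (fun U : ℕ => Real.log (U : ℝ)) atTop atTop :=
  Real.tendsto_log_atTop.comp tendsto_natCast_atTop_atTop

theorem IsSeparated.tendsto_codebookThroughput (hNt : 2 ≤ Nt) (hM : 1 ≤ M) {W : Codebook Nt M}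
    {m : Fin M} (hW : IsSeparated W m) :
    Tendsto (fun U : ℕ => codebookThroughput W U / ((Nt : ℝ) / ((Nt : ℝ) - 1) * Real.log (U : ℝ)))
      atTop (𝓝 1) := by
  have hN2 : (2 : ℝ) ≤ Nt := by exact_mod_cast hNt
  have hN : (0 : ℝ) < Nt - 1 := by linarith
  have hpos : ∀ U : ℕ, 2 ≤ U → 0 < Real.log (U : ℝ) := fun U hU =>
    Real.log_pos (by exact_mod_cast hU)
  refine tendsto_order.2 ⟨fun b hb => ?_, fun b hb => ?_⟩
  · obtain ⟨d, hd0, hd1, hdb⟩ : ∃ d : ℝ, 0 < d ∧ d < 1 ∧ b < 1 - d := by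
      refine ⟨min ((1 - b) / 2) (1 / 2), by apply lt_min <;> linarith,
        (min_le_right _ _).trans_lt (by norm_num), ?_⟩
      linarith [min_le_left ((1 - b) / 2) (1 / 2)]
    obtain ⟨c, hc, r, hr, hlow⟩ := hW.exists_le_codebookThroughput hNt hM
    have hs : 0 < (1 - d) / ((Nt : ℝ) - 1) := div_pos (by linarith) hN
    -- For this radius `x`, the bound `c * x ^ (Nt - 1) * U` on the expected number of users in the
    -- ball is `c * U ^ d`, which diverges, while `-log x` loses only the factor `1 - d`.
    have hx : ∀ᶠ U : ℕ in atTop, (U : ℝ) ^ (-((1 - d) / ((Nt : ℝ) - 1))) ≤ r :=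
      ((tendsto_rpow_neg_atTop hs).comp tendsto_natCast_atTop_atTop).eventually_le_const hr
    have hlim : Tendsto (fun U : ℕ => (1 - d) * (1 - Real.exp (-(c * (U : ℝ) ^ d)))) atTop
        (𝓝 ((1 - d) * (1 - 0))) := by
      refine Tendsto.const_mul _ (tendsto_const_nhds.sub ?_)
      refine Real.tendsto_exp_neg_atTop_nhds_zero.comp (Tendsto.const_mul_atTop hc ?_)
      exact (tendsto_rpow_atTop hd0).comp tendsto_natCast_atTop_atTop
    rw [sub_zero, mul_one] at hlim
    filter_upwards [hx, hlim.eventually_const_lt hdb, eventually_ge_atTop 2] with U hU hUb hU2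
    refine hUb.trans_le ?_
    have hU0 : (0 : ℝ) < U := by positivity
    have hlog := hpos U hU2
    have h := hlow _ (Real.rpow_pos_of_pos hU0 _) hU U
    rw [Real.log_rpow hU0, ← Real.rpow_mul hU0.le, neg_mul ((1 - d) / ((Nt : ℝ) - 1)) (Nt - 1),
      div_mul_cancel₀ _ hN.ne', mul_assoc c] at h
    have hUd : (U : ℝ) ^ (-(1 - d)) * U = (U : ℝ) ^ d := by
      rw [← Real.rpow_add_one hU0.ne']
      ring_nf
    rw [hUd] at h
    rw [le_div_iff₀ (by positivity)]
    refine le_trans (le_of_eq ?_) h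
    field_simp
  · obtain ⟨lam, hlb, hl0, hl1⟩ : ∃ lam : ℝ, ((Nt : ℝ) - 1) / lam < b ∧ 0 < lam ∧
        lam < Nt - 1 := by
      have hb0 : 0 < b := by linarith
      have h1 : ((Nt : ℝ) - 1) / b < Nt - 1 := div_lt_self hN hb
      obtain ⟨lam, hlam, hlam'⟩ := exists_between h1
      have hl0 : 0 < lam := (div_pos hN hb0).trans hlam
      refine ⟨lam, ?_, hl0, hlam'⟩
      rwa [div_lt_iff₀ hl0, mul_comm, ← div_lt_iff₀ hb0]
    obtain ⟨K, hK, hup⟩ := exists_codebookThroughput_le (M := M) hNt hM hl0 hl1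
    have hlim : Tendsto (fun U : ℕ => ((Nt : ℝ) - 1) / lam * (1 + Real.log K / Real.log (U : ℝ)))
        atTop (𝓝 (((Nt : ℝ) - 1) / lam * (1 + 0))) :=
      Tendsto.const_mul _ (tendsto_const_nhds.add
        (tendsto_const_nhds.div_atTop tendsto_log_natCast_atTop))
    rw [add_zero, mul_one] at hlim
    filter_upwards [hlim.eventually_lt_const hlb, eventually_ge_atTop 2] with U hUb hU2
    refine lt_of_le_of_lt ?_ hUb
    have hlog := hpos U hU2
    have h := (hup W U).2
    rw [max_eq_left (by omega : 1 ≤ U)] at h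
    rw [div_le_iff₀ (by positivity)]
    refine h.trans (le_of_eq ?_)
    field_simp

theorem integrable_sumRate (hNt : 2 ≤ Nt) (hM : 1 ≤ M) (U : ℕ) :
    Integrable (fun x : Codebook Nt M × (Fin U → EuclideanSpace ℂ (Fin Nt)) => sumRate x.1 x.2)
      ((codebookLaw Nt M).prod (channelsLaw Nt U)) := by
  have : Nonempty (Fin M × Fin Nt) := ⟨(⟨0, by omega⟩, ⟨0, by omega⟩)⟩
  have hN2 : (2 : ℝ) ≤ Nt := by exact_mod_cast hNt
  obtain ⟨K, -, hK⟩ := exists_codebookThroughput_le (M := M) hNt hM (lam := 1 / 2) (by norm_num)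
    (by linarith)
  have hm := (measurable_sumRate (Nt := Nt) (M := M) (U := U)).aestronglyMeasurable
    (μ := (codebookLaw Nt M).prod (channelsLaw Nt U))
  rw [integrable_prod_iff hm]
  refine ⟨ae_of_all _ fun W => (hK W U).1, ?_⟩
  refine (integrable_const (Nt / (1 / 2) * (Real.log (max U 1 : ℕ) + Real.log K))).mono'
    hm.norm.integral_prod_right' (ae_of_all _ fun W => ?_)
  have hnn : ∀ h : Fin U → EuclideanSpace ℂ (Fin Nt), ‖sumRate W h‖ = sumRate W h := fun h =>
    Real.norm_of_nonneg (sumRate_nonneg W h)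
  simp only [hnn]
  rw [Real.norm_of_nonneg (integral_nonneg fun h => sumRate_nonneg W h)]
  exact (hK W U).2

theorem throughput_eq_integral (hNt : 2 ≤ Nt) (hM : 1 ≤ M) (U : ℕ) :
    throughput Nt M U = ∫ W, codebookThroughput W U ∂(codebookLaw Nt M) :=
  integral_prod _ (integrable_sumRate hNt hM U)

theorem tendsto_throughput (hNt : 2 ≤ Nt) (hM : 1 ≤ M) :
    Tendsto (fun U : ℕ => throughput Nt M U / ((Nt : ℝ) / ((Nt : ℝ) - 1) * Real.log (U : ℝ)))
      atTop (𝓝 1) := by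
  have : Nonempty (Fin M × Fin Nt) := ⟨(⟨0, by omega⟩, ⟨0, by omega⟩)⟩
  have hN2 : (2 : ℝ) ≤ Nt := by exact_mod_cast hNt
  have hN : (0 : ℝ) < Nt - 1 := by linarith
  -- Domination needs no sharp constant: `1 / 2` is below `Nt - 1` for every admissible `Nt`.
  obtain ⟨K, hK0, hK⟩ := exists_codebookThroughput_le (M := M) hNt hM (lam := 1 / 2) (by norm_num)
    (by linarith)
  have hlim : Tendsto (fun U : ℕ => ((Nt : ℝ) - 1) / (1 / 2) *
      (1 + Real.log K / Real.log (U : ℝ))) atTop (𝓝 (((Nt : ℝ) - 1) / (1 / 2) * (1 + 0))) :=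
    Tendsto.const_mul _ (tendsto_const_nhds.add
      (tendsto_const_nhds.div_atTop tendsto_log_natCast_atTop))
  have heq : (fun U : ℕ => throughput Nt M U / ((Nt : ℝ) / ((Nt : ℝ) - 1) * Real.log (U : ℝ))) =
      fun U : ℕ => ∫ W, codebookThroughput W U / ((Nt : ℝ) / ((Nt : ℝ) - 1) * Real.log (U : ℝ))
        ∂(codebookLaw Nt M) := by
    ext U
    rw [integral_div, throughput_eq_integral hNt hM]
  have hone : ∫ _W : Codebook Nt M, (1 : ℝ) ∂(codebookLaw Nt M) = 1 := by simp
  rw [heq]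
  refine Tendsto.mono_right ?_ (congrArg 𝓝 hone).le
  refine tendsto_integral_filter_of_dominated_convergence
    (fun _ => ((Nt : ℝ) - 1) / (1 / 2) * (1 + 0) + 1) ?_ ?_ (integrable_const _) ?_
  · refine Eventually.of_forall fun U => ?_
    have hm := ((measurable_sumRate (Nt := Nt) (M := M) (U := U)).aestronglyMeasurable
      (μ := (codebookLaw Nt M).prod (channelsLaw Nt U))).integral_prod_right'
    exact (hm.aemeasurable.div_const _).aestronglyMeasurable
  · filter_upwards [hlim.eventually_lt_const (lt_add_one _), eventually_ge_atTop 2] with U hUb hU2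
    refine ae_of_all _ fun W => ?_
    have hlog : 0 < Real.log (U : ℝ) := Real.log_pos (by exact_mod_cast hU2)
    have h0 : 0 ≤ codebookThroughput W U := integral_nonneg fun h => sumRate_nonneg W h
    rw [Real.norm_of_nonneg (by positivity)]
    refine le_trans ?_ hUb.le
    have h := (hK W U).2
    rw [max_eq_left (by omega : 1 ≤ U)] at h
    rw [div_le_iff₀ (by positivity)]
    refine h.trans (le_of_eq ?_)
    field_simp
  · filter_upwards [ae_isSeparated hNt (⟨0, by omega⟩ : Fin M)] with W hW
    exact hW.tendsto_codebookThroughput hNt hM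

end PU2RC
end

theorem proposition2 (Nt M : ℕ) (hNt : 2 ≤ Nt) (hM : 1 ≤ M) :
    ((∀ U : ℕ, Integrable
        (fun x : PU2RC.Codebook Nt M × (Fin U → EuclideanSpace ℂ (Fin Nt)) =>
          PU2RC.sumRate x.1 x.2)
        ((PU2RC.codebookLaw Nt M).prod (PU2RC.channelsLaw Nt U))) ∧
      Tendsto (fun U : ℕ =>
          PU2RC.throughput Nt M U / ((Nt : ℝ) / ((Nt : ℝ) - 1) * Real.log (U : ℝ)))
        atTop (𝓝 1)) ∧
    ∀ᵐ W ∂(PU2RC.codebookLaw Nt M),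
      (∀ U : ℕ, Integrable
        (fun h : Fin U → EuclideanSpace ℂ (Fin Nt) => PU2RC.sumRate W h)
        (PU2RC.channelsLaw Nt U)) ∧
      Tendsto (fun U : ℕ =>
          PU2RC.codebookThroughput W U / ((Nt : ℝ) / ((Nt : ℝ) - 1) * Real.log (U : ℝ)))
        atTop (𝓝 1) := by
  have hN2 : (2 : ℝ) ≤ Nt := by exact_mod_cast hNt
  refine ⟨⟨PU2RC.integrable_sumRate hNt hM, PU2RC.tendsto_throughput hNt hM⟩, ?_⟩
  obtain ⟨K, -, hK⟩ := PU2RC.exists_codebookThroughput_le (M := M) hNt hM (lam := 1 / 2)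
    (by norm_num) (by linarith)
  filter_upwards [PU2RC.ae_isSeparated hNt (⟨0, by omega⟩ : Fin M)] with W hW
  exact ⟨fun U => (hK W U).1, hW.tendsto_codebookThroughput hNt hM⟩
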